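/- Let $(M,\mu)$ be a finite measure space and let $\mathcal E$ be a Dirichlet form on the real space $L^2(M,\mu)$: a symmetric nonnegative bilinear form on a dense subspace $\mathcal D(\mathcal E)\subset L^2(M,\mu)$, closed (i.e. $\mathcal D(\mathcal E)$ is complete for the norm $(\mathcal E(v)+\|v\|_{L^2}^2)^{1/2}$, where $\mathcal E(v):=\mathcal E(v,v)$), and Markovian: if $v\in\mathcal D(\mathcal E)$ then $|v|\in\mathcal D(\mathcal E)$ and $\mathcal E(|v|)\le\mathcal E(v)$; and if moreover $v\ge 0$ then $\inf\{v,1\}\in\mathcal D(\mathcal E)$ and $\mathcal E(\inf\{v,1\})\le\mathcal E(v)$. Suppose that for some $\nu>2$ and some constants $A,B>0$ the Sobolev inequality $$\|v\|_{L^{2\nu/(\nu-2)}}^2\le A\,\mathcal E(v)+B\,\|v\|_{L^2}^2\qquad\text{for all } v\in\mathcal D(\mathcal E)$$ holds. Let $V$ be a real-valued integrable function on $M$ whose negative part $V_-=\sup\{0,-V\}$ is infinitesimally form bounded with respect to $\mathcal E$: for every $\varepsilon>0$ there is a constant $c(\varepsilon)$ such that $$\int_M V_-v^2\,d\mu\le\varepsilon\,\mathcal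 E(v)+c(\varepsilon)\int_M v^2\,d\mu\qquad\text{for all } v\in\mathcal D(\mathcal E).$$ Put $\mathcal D(\mathcal E_V)=\{v\in\mathcal D(\mathcal E):\int_M Vv^2\,d\mu<\infty\}$, $\mathcal E_V(v)=\mathcal E(v)+\int_M Vv^2\,d\mu$ for $v\in\mathcal D(\mathcal E_V)$, and $$Y(V)=\inf\{\mathcal E_V(v): v\in\mathcal D(\mathcal E_V),\ \|v\|_{L^{2\nu/(\nu-2)}}=1\}\in[-\infty,+\infty]\qquad(\inf\emptyset=+\infty).$$ If $Y(V)<1/A$, then there exists $v\in\mathcal D(\mathcal E_V)$ such that $\mathcal E_V(v)=Y(V)$ and $\|v\|_{L^{2\nu/(\nu-2)}}=1$. -/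

import Mathlib

open MeasureTheory Filter Topology

noncomputable section

/-- A (symmetric) Dirichlet form on the real Hilbert space `L²(M, μ)`, where `μ` is a finite measure:
a densely defined, nonnegative, closed, symmetric bilinear form with the Markov property,
the latter being expressed by the Beurling–Deny conditions. -/
structure DirichletForm {M : Type*} [MeasurableSpace M] (μ : Measure M) [IsFiniteMeasure μ] where
  /-- the form domain `𝓓(𝓔)` -/
  domain : Submodule ℝ (Lp ℝ 2 μ)
  /-- the bilinear form `𝓔(u, v)` -/
  form : domain →ₗ[ℝ] domain →ₗ[ℝ] ℝ
  dense_domain : Dense (domain : Set (Lp ℝ 2 μ))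
  symm : ∀ u v, form u v = form v u
  nonneg : ∀ v, 0 ≤ form v v
  /-- closedness: `𝓓(𝓔)` is complete for the norm `(𝓔(v, v) + ‖v‖²)^{1/2}` -/
  closed : ∀ u : ℕ → domain,
    Tendsto (fun p : ℕ × ℕ => form (u p.1 - u p.2) (u p.1 - u p.2) + ‖u p.1 - u p.2‖ ^ 2)
      atTop (𝓝 0) →
    ∃ w : domain, Tendsto (fun n => form (u n - w) (u n - w) + ‖u n - w‖ ^ 2) atTop (𝓝 0)
  /-- `v ∈ 𝓓(𝓔)` implies `|v| ∈ 𝓓(𝓔)` and `𝓔(|v|) ≤ 𝓔(v)` -/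
  abs_contraction : ∀ v : domain, ∃ w : domain,
    (w : Lp ℝ 2 μ) = |(v : Lp ℝ 2 μ)| ∧ form w w ≤ form v v
  /-- `0 ≤ v ∈ 𝓓(𝓔)` implies `inf {v, 1} ∈ 𝓓(𝓔)` and `𝓔(inf {v, 1}) ≤ 𝓔(v)` -/
  unit_contraction : ∀ v : domain, 0 ≤ (v : Lp ℝ 2 μ) → ∃ w : domain,
    (w : Lp ℝ 2 μ) = (v : Lp ℝ 2 μ) ⊓ Lp.const 2 μ (1 : ℝ) ∧ form w w ≤ form v v

/-- The Sobolev exponent `2ν / (ν - 2)`. -/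
def sobolevExponent (ν : ℝ) : ENNReal := ENNReal.ofReal (2 * ν / (ν - 2))

namespace DirichletForm

variable {M : Type*} [MeasurableSpace M] {μ : Measure M} [IsFiniteMeasure μ]

/-- The quadratic form `𝓔(v) = 𝓔(v, v)`. -/
def energy (E : DirichletForm μ) (v : E.domain) : ℝ := E.form v v

/-- The Sobolev inequality `‖v‖²_{L^{2ν/(ν-2)}} ≤ A 𝓔(v) + B ‖v‖²_{L²}` for all `v ∈ 𝓓(𝓔)`. -/
def SobolevInequality (E : DirichletForm μ) (ν A B : ℝ) : Prop :=
  ∀ v : E.domain, MemLp (v : Lp ℝ 2 μ) (sobolevExponent ν) μ ∧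
    (eLpNorm (v : Lp ℝ 2 μ) (sobolevExponent ν) μ).toReal ^ 2 ≤ A * E.energy v + B * ‖v‖ ^ 2

/-- Infinitesimal form boundedness of a nonnegative function `W` with respect to `𝓔`. -/
def InfinitesimallyFormBounded (E : DirichletForm μ) (W : M → ℝ) : Prop :=
  ∀ ε : ℝ, 0 < ε → ∃ c : ℝ, ∀ v : E.domain,
    Integrable (fun x => W x * (v : Lp ℝ 2 μ) x ^ 2) μ ∧
      ∫ x, W x * (v : Lp ℝ 2 μ) x ^ 2 ∂μ ≤ ε * E.energy v + c * ‖v‖ ^ 2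

/-- The domain `𝓓(𝓔_V)` of those `v ∈ 𝓓(𝓔)` with `∫ V v² < ∞`. (When `V₋` is form bounded,
`V₋ v²` is integrable for all `v ∈ 𝓓(𝓔)`, and `∫ V v² < ∞` says that `V v²` is integrable.) -/
def schrodingerDomain (E : DirichletForm μ) (V : M → ℝ) : Set E.domain :=
  {v | Integrable (fun x => V x * (v : Lp ℝ 2 μ) x ^ 2) μ}

/-- The quadratic form `𝓔_V(v) = 𝓔(v) + ∫ V v²`, meaningful for `v ∈ 𝓓(𝓔_V)`. -/
def schrodingerEnergy (E : DirichletForm μ) (V : M → ℝ) (v : E.domain) : ℝ :=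
  E.energy v + ∫ x, V x * (v : Lp ℝ 2 μ) x ^ 2 ∂μ

/-- The Yamabe invariant `Y(V)`: the infimum, in the extended reals, of `𝓔_V` over the
functions with `‖v‖_{L^{2ν/(ν-2)}} = 1`. Elements of `𝓓(𝓔)` outside `𝓓(𝓔_V)`, where `𝓔_V = +∞`,
do not contribute. -/
def yamabeInvariant (E : DirichletForm μ) (ν : ℝ) (V : M → ℝ) : EReal :=
  ⨅ v ∈ {v : E.domain | v ∈ E.schrodingerDomain V ∧
      eLpNorm (v : Lp ℝ 2 μ) (sobolevExponent ν) μ = 1},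
    (E.schrodingerEnergy V v : EReal)

end DirichletForm

end

/-! This is the direct method in the style of Brezis–Nirenberg. Put p = 2ν/(ν-2). Infinitesimal form
boundedness makes `𝓔_V` coercive, and the constraint bounds the L² norm because μ is finite and p >
2. Hence Y(V) is a real number y, a minimizing sequence u_n is bounded in the form norm, and a
subsequence converges weakly to some v.

The embedding of the form domain into L² is compact, so u_n → v in L² and, along a subsequence,
almost everywhere. Compactness may still fail in Lᵖ: an energy e = lim 𝓔(u_n - v) ≥ 0 may be lost.
Fatou for V₊ and form boundedness for V₋ give 𝓔_V(v) + e ≤ y. With a = ∫|v|ᵖ, homogeneity turns this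
into y a^{2/p} + e ≤ y, while Brezis–Lieb and the Sobolev inequality for u_n - v give (1 - a)^{2/p}
≤ A e. As y < 1/A, these force a = 1 (`eq_one_of_split`); then v is admissible and 𝓔_V(v) ≤ y.

Compactness of the embedding needs an argument, since no geometry is available. By De Giorgi
iteration on level sets, the resolvent (1 + L)⁻¹ sends functions bounded by 1 with small L² norm to
uniformly small functions (`exists_resolvent_le`). Averages of a weakly null sequence bounded in L∞
have small L² norm, so the resolvents of such a sequence tend to 0 almost everywhere
(`ae_tendsto_resolvent_zero`), and in L² by domination. A form ball lies within ε of the resolvent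
image of an L∞ ball, by truncation and by the resolvent of c𝓔 with c small, and is therefore totally
bounded. -/

/-! ### Weak sequences, iteration and Fatou -/

theorem exists_subseq_tendsto_inner {H : Type*} [NormedAddCommGroup H] [InnerProductSpace ℝ H]
    [CompleteSpace H] (u : ℕ → H) (R : ℝ) (hu : ∀ n, ‖u n‖ ≤ R) :
    ∃ (v : H) (φ : ℕ → ℕ), StrictMono φ ∧
      ∀ w, Tendsto (fun n => inner ℝ (u (φ n)) w) atTop (𝓝 (inner ℝ v w)) := by
  -- The space need not be separable, but the closed span of the sequence is. Banach–Alaoglu is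
  -- sequential there, and a vector of H is seen by K only through its projection.
  let K : Submodule ℝ H := (Submodule.span ℝ (Set.range u)).topologicalClosure
  have hKc : IsClosed (K : Set H) := Submodule.isClosed_topologicalClosure _
  have : CompleteSpace K := hKc.completeSpace_coe
  have hsep : TopologicalSpace.IsSeparable (K : Set H) := by
    have h1 : TopologicalSpace.IsSeparable (Submodule.span ℝ (Set.range u) : Set H) :=
      (Set.countable_range u).isSeparable.span
    exact h1.closure
  have : TopologicalSpace.SeparableSpace K := hsep.separableSpace
  have huK : ∀ n, u n ∈ K := fun n =>
    Submodule.le_topologicalClosure _ (Submodule.subset_span ⟨n, rfl⟩)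
  let f : ℕ → WeakDual ℝ K := fun n =>
    StrongDual.toWeakDual (InnerProductSpace.toDual ℝ K ⟨u n, huK n⟩)
  obtain ⟨g, -, φ, hφ, hg⟩ := WeakDual.isSeqCompact_closedBall ℝ K (0 : StrongDual ℝ K) R
    (x := f) (by
      intro n
      simp only [f, Set.mem_preimage, Metric.mem_closedBall, dist_zero_right]
      change ‖(InnerProductSpace.toDual ℝ K) ⟨u n, huK n⟩‖ ≤ R
      rw [LinearIsometryEquiv.norm_map]
      exact hu n)
  let v : K := (InnerProductSpace.toDual ℝ K).symm (WeakDual.toStrongDual g)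
  refine ⟨v, φ, hφ, fun w => ?_⟩
  have key : ∀ k : K, inner ℝ (k : H) w = inner ℝ k (K.orthogonalProjectionOnto w) := by
    intro k
    rw [Submodule.coe_inner]
    have h := Submodule.inner_starProjection_left_eq_right K (k : H) w
    rwa [Submodule.starProjection_eq_self_iff.2 k.2] at h
  have h2 := (WeakDual.eval_continuous (K.orthogonalProjectionOnto w)).tendsto g |>.comp hg
  have h3 : inner ℝ (v : H) w = g (K.orthogonalProjectionOnto w) := by
    rw [key]
    simp only [v]
    rw [InnerProductSpace.toDual_symm_apply]; rfl
  rw [h3]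
  refine h2.congr fun n => ?_
  rw [key ⟨u (φ n), huK _⟩]
  rfl

/-- Greedy choice: weak convergence supplies a new index in I whose vector has inner product below
1/2 with the current sum, so each step adds at most K² + 1 to the squared norm. Growth linear in m,
not quadratic, makes averages small. -/
theorem exists_finset_norm_sum_sq_le {H : Type*} [NormedAddCommGroup H] [InnerProductSpace ℝ H]
    (z : ℕ → H) (K : ℝ) (hz : ∀ n, ‖z n‖ ≤ K)
    (hw : ∀ w, Tendsto (fun n => inner ℝ (z n) w) atTop (𝓝 0))
    (I : Set ℕ) (hI : I.Infinite) (m : ℕ) :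
    ∃ F : Finset ℕ, (F : Set ℕ) ⊆ I ∧ F.card = m ∧ ‖∑ n ∈ F, z n‖ ^ 2 ≤ m * (K ^ 2 + 1) := by
  induction m with
  | zero => exact ⟨∅, by simp, by simp, by simp⟩
  | succ m ih =>
    obtain ⟨F, hFI, hFc, hF⟩ := ih
    have h1 : ∀ᶠ n in atTop, inner ℝ (z n) (∑ n ∈ F, z n) < 1 / 2 :=
      (hw _).eventually (gt_mem_nhds (by norm_num))
    have h2 : ∀ᶠ n in atTop, n ∉ F := by
      have := F.finite_toSet.eventually_cofinite_notMem
      rw [Nat.cofinite_eq_atTop] at this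
      exact this
    have h3 : ∃ᶠ n in atTop, n ∈ I := Nat.frequently_atTop_iff_infinite.2 hI
    obtain ⟨n, hnI, hn1, hn2⟩ := (h3.and_eventually (h1.and h2)).exists
    refine ⟨insert n F, ?_, ?_, ?_⟩
    · rw [Finset.coe_insert]
      exact Set.insert_subset hnI hFI
    · rw [Finset.card_insert_of_notMem hn2, hFc]
    · rw [Finset.sum_insert hn2, norm_add_sq_real]
      have h4 : ‖z n‖ ^ 2 ≤ K ^ 2 := pow_le_pow_left₀ (norm_nonneg _) (hz n) 2
      push_cast
      nlinarith

/-- The De Giorgi iteration lemma. The bound y j ≤ δ rʲ reproduces itself when r^α = 1/b, which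
absorbs bʲ, and δ^α = r/C, which absorbs C and leaves a factor r. -/
theorem exists_forall_tendsto_zero_of_le_geometric_mul_rpow (C b α : ℝ) (hC : 0 < C) (hb : 1 < b)
    (hα : 0 < α) :
    ∃ δ : ℝ, 0 < δ ∧ ∀ y : ℕ → ℝ, (∀ j, 0 ≤ y j) →
      (∀ j, y (j + 1) ≤ C * b ^ j * y j ^ (1 + α)) → y 0 ≤ δ → Tendsto y atTop (𝓝 0) := by
  have hb0 : 0 < b := by linarith
  set r : ℝ := b ^ (-(1 / α)) with hr
  have hr0 : 0 < r := Real.rpow_pos_of_pos hb0 _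
  have hr1 : r < 1 := Real.rpow_lt_one_of_one_lt_of_neg hb (by
    rw [neg_lt_zero]; positivity)
  have hrα : r ^ α = b⁻¹ := by
    rw [hr, ← Real.rpow_mul hb0.le, neg_mul, one_div, inv_mul_cancel₀ hα.ne', Real.rpow_neg_one]
  set δ : ℝ := (r / C) ^ (1 / α) with hδ
  have hδ0 : 0 < δ := Real.rpow_pos_of_pos (by positivity) _
  have hδα : δ ^ α = r / C := by
    rw [hδ, ← Real.rpow_mul (by positivity), one_div, inv_mul_cancel₀ hα.ne', Real.rpow_one]
  refine ⟨δ, hδ0, fun y hy hrec h0 => ?_⟩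
  have hbd : ∀ j, y j ≤ δ * r ^ j := by
    intro j
    induction j with
    | zero => simpa using h0
    | succ j ih =>
      calc y (j + 1) ≤ C * b ^ j * y j ^ (1 + α) := hrec j
        _ ≤ C * b ^ j * (δ * r ^ j) ^ (1 + α) := by
          gcongr
          exact hy j
        _ = C * b ^ j * ((δ * r ^ j) * (δ ^ α * (r ^ α) ^ j)) := by
          rw [Real.rpow_add (by positivity), Real.rpow_one,
            Real.mul_rpow hδ0.le (by positivity), ← Real.rpow_natCast r j, ← Real.rpow_mul hr0.le,
            mul_comm (j : ℝ) α, Real.rpow_mul hr0.le, Real.rpow_natCast, Real.rpow_natCast]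
        _ = δ * r ^ (j + 1) := by
          rw [hδα, hrα, inv_pow, pow_succ]
          field_simp
  refine squeeze_zero hy hbd ?_
  simpa using (tendsto_pow_atTop_nhds_zero_of_lt_one hr0.le hr1).const_mul δ

theorem integrable_and_integral_le_of_tendsto {M : Type*} [MeasurableSpace M] {μ : Measure M}
    (f : ℕ → M → ℝ) (g : M → ℝ) (b : ℕ → ℝ) (c : ℝ) (hf : ∀ n, Integrable (f n) μ)
    (hf0 : ∀ n, ∀ᵐ x ∂μ, 0 ≤ f n x) (hg : ∀ᵐ x ∂μ, Tendsto (fun n => f n x) atTop (𝓝 (g x)))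
    (hb : ∀ n, ∫ x, f n x ∂μ ≤ b n) (hc : Tendsto b atTop (𝓝 c)) :
    Integrable g μ ∧ ∫ x, g x ∂μ ≤ c := by
  have hgm : AEStronglyMeasurable g μ :=
    aestronglyMeasurable_of_tendsto_ae atTop (fun n => (hf n).1) hg
  have hg0 : 0 ≤ᵐ[μ] g := by
    filter_upwards [hg, ae_all_iff.2 hf0] with x h1 h2
    exact ge_of_tendsto' h1 h2
  have hc0 : 0 ≤ c := ge_of_tendsto' hc fun n => (integral_nonneg_of_ae (hf0 n)).trans (hb n)
  have key : ∫⁻ x, ENNReal.ofReal (g x) ∂μ ≤ ENNReal.ofReal c := by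
    have h1 : ∫⁻ x, ENNReal.ofReal (g x) ∂μ
        = ∫⁻ x, liminf (fun n => ENNReal.ofReal (f n x)) atTop ∂μ := by
      refine lintegral_congr_ae ?_
      filter_upwards [hg] with x hx
      exact ((ENNReal.continuous_ofReal.tendsto _).comp hx).liminf_eq.symm
    have h2 : Tendsto (fun n => ENNReal.ofReal (b n)) atTop (𝓝 (ENNReal.ofReal c)) :=
      (ENNReal.continuous_ofReal.tendsto _).comp hc
    rw [h1, ← h2.liminf_eq]
    refine (lintegral_liminf_le' fun n => (hf n).1.aemeasurable.ennreal_ofReal).trans ?_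
    refine liminf_le_liminf (Eventually.of_forall fun n => ?_)
    rw [← ofReal_integral_eq_lintegral_ofReal (hf n) (hf0 n)]
    exact ENNReal.ofReal_le_ofReal (hb n)
  refine ⟨⟨hgm, ?_⟩, ?_⟩
  · rw [hasFiniteIntegral_iff_ofReal hg0]
    exact key.trans_lt ENNReal.ofReal_lt_top
  · rw [integral_eq_lintegral_of_nonneg_ae hg0 hgm]
    exact ENNReal.toReal_le_of_le_ofReal hc0 key

/-! ### L² and Lᵖ estimates -/

theorem lp_inner_eq {M : Type*} [MeasurableSpace M] {μ : Measure M}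
    (f g : Lp ℝ 2 μ) : inner ℝ f g = ∫ x, f x * g x ∂μ := by
  rw [L2.inner_def]
  refine integral_congr_ae (Eventually.of_forall fun x => ?_)
  simp [mul_comm]

theorem integrable_lp_mul {M : Type*} [MeasurableSpace M] {μ : Measure M}
    (f g : Lp ℝ 2 μ) : Integrable (fun x => f x * g x) μ := by
  refine (L2.integrable_inner (𝕜 := ℝ) g f).congr (Eventually.of_forall fun x => ?_)
  simp

theorem lp_norm_sq_eq {M : Type*} [MeasurableSpace M] {μ : Measure M}
    (f : Lp ℝ 2 μ) : ‖f‖ ^ 2 = ∫ x, f x ^ 2 ∂μ := by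
  rw [← real_inner_self_eq_norm_sq, lp_inner_eq]
  simp only [sq]

theorem rpow_mul_measureReal_le {M : Type*} [MeasurableSpace M] {μ : Measure M} {p : ℝ} (hp : 0 < p)
    (w : M → ℝ) (hw : MemLp w (ENNReal.ofReal p) μ) (c : ℝ) (hc : 0 < c) :
    c ^ p * μ.real {x | c ≤ |w x|} ≤ (eLpNorm w (ENNReal.ofReal p) μ).toReal ^ p := by
  have h := mul_meas_ge_le_pow_eLpNorm' μ (p := ENNReal.ofReal p) (by simpa using hp)
    ENNReal.ofReal_ne_top hw.1 (ENNReal.ofReal c)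
  rw [ENNReal.toReal_ofReal hp.le] at h
  have h1 : {x | ENNReal.ofReal c ≤ (‖w x‖₊ : ENNReal)} = {x | c ≤ |w x|} := by
    ext x
    simp only [Set.mem_ofPred_eq]
    rw [← ENNReal.ofReal_coe_nnreal, ENNReal.ofReal_le_ofReal_iff (NNReal.coe_nonneg _),
      coe_nnnorm, Real.norm_eq_abs]
  have h1' : {x | ENNReal.ofReal c ≤ ‖w x‖ₑ} = {x | c ≤ |w x|} := h1
  rw [h1'] at h
  have h2 := ENNReal.toReal_mono (ENNReal.rpow_ne_top_of_nonneg hp.le hw.2.ne) h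
  rwa [ENNReal.toReal_mul, ← ENNReal.toReal_rpow, ← ENNReal.toReal_rpow,
    ENNReal.toReal_ofReal hc.le] at h2

theorem integral_abs_le_of_eq_zero_off {M : Type*} [MeasurableSpace M] {μ : Measure M}
    [IsFiniteMeasure μ] {p : ℝ} (hp : 2 < p) (w : M → ℝ)
    (hw : MemLp w (ENNReal.ofReal p) μ) {S : Set M} (hS : MeasurableSet S)
    (h0 : ∀ᵐ x ∂μ, x ∉ S → w x = 0) :
    ∫ x, |w x| ∂μ ≤ (eLpNorm w (ENNReal.ofReal p) μ).toReal * μ.real S ^ (1 - 1 / p) := by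
  have hp0 : 0 < p := by linarith
  have h1 : ∫ x, |w x| ∂μ = (eLpNorm w 1 μ).toReal := by
    rw [eLpNorm_one_eq_lintegral_enorm, ← integral_norm_eq_lintegral_enorm hw.1]
    rfl
  have h2 : eLpNorm w 1 μ = eLpNorm w 1 (μ.restrict S) := by
    rw [← eLpNorm_indicator_eq_eLpNorm_restrict hS]
    refine eLpNorm_congr_ae ?_
    filter_upwards [h0] with x hx
    by_cases h : x ∈ S
    · simp [h]
    · simp [h, hx h]
  have h3 : eLpNorm w 1 (μ.restrict S) ≤
      eLpNorm w (ENNReal.ofReal p) (μ.restrict S) * μ S ^ (1 - 1 / p) := by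
    have h := eLpNorm_le_eLpNorm_mul_rpow_measure_univ (μ := μ.restrict S) (p := 1)
      (q := ENNReal.ofReal p) (by
        rw [← ENNReal.ofReal_one]
        exact ENNReal.ofReal_le_ofReal (by linarith)) hw.1.restrict
    rw [Measure.restrict_apply_univ, ENNReal.toReal_ofReal hp0.le] at h
    simpa using h
  have h4 := eLpNorm_mono_measure w (Measure.restrict_le_self (μ := μ) (s := S))
    (p := ENNReal.ofReal p)
  rw [h1, h2, Measure.real, ENNReal.toReal_rpow, ← ENNReal.toReal_mul]
  refine ENNReal.toReal_mono ?_ (h3.trans (by gcongr))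
  refine ENNReal.mul_ne_top hw.2.ne (ENNReal.rpow_ne_top_of_nonneg ?_ (measure_ne_top _ _))
  rw [sub_nonneg, div_le_one hp0]
  linarith

theorem integral_abs_rpow_eq {M : Type*} [MeasurableSpace M] {μ : Measure M} {p : ℝ} (hp : 0 < p)
    (w : M → ℝ) (hw : MemLp w (ENNReal.ofReal p) μ) :
    Integrable (fun x => |w x| ^ p) μ ∧
      ∫ x, |w x| ^ p ∂μ = (eLpNorm w (ENNReal.ofReal p) μ).toReal ^ p := by
  have h0 : ENNReal.ofReal p ≠ 0 := by simpa using hp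
  have h1 := hw.integrable_norm_rpow h0 ENNReal.ofReal_ne_top
  have h2 := hw.eLpNorm_eq_integral_rpow_norm h0 ENNReal.ofReal_ne_top
  rw [ENNReal.toReal_ofReal hp.le] at h1 h2
  have h3 : 0 ≤ ∫ x, ‖w x‖ ^ p ∂μ := integral_nonneg fun x => by positivity
  refine ⟨h1, ?_⟩
  rw [h2, ENNReal.toReal_ofReal (by positivity), ← Real.rpow_mul h3, inv_mul_cancel₀ hp.ne',
    Real.rpow_one]
  rfl

theorem ae_abs_smul_sum_le {M : Type*} [MeasurableSpace M] {μ : Measure M}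
    (z : ℕ → Lp ℝ 2 μ) (N : ℝ) (hz : ∀ n, ∀ᵐ x ∂μ, |z n x| ≤ N)
    (F : Finset ℕ) (c : ℝ) (hc : 0 ≤ c) (hcF : c * (F.card * N) ≤ 1) :
    ∀ᵐ x ∂μ, |(c • ∑ i ∈ F, z i : Lp ℝ 2 μ) x| ≤ 1 := by
  have h1 := Lp.coeFn_smul c (∑ i ∈ F, z i)
  have h2 := Lp.coeFn_finsetSum F z
  filter_upwards [h1, h2, ae_all_iff.2 hz] with x h1 h2 h3
  rw [h1, Pi.smul_apply, h2, smul_eq_mul, abs_mul, abs_of_nonneg hc]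
  refine le_trans (mul_le_mul_of_nonneg_left ?_ hc) hcF
  rw [Finset.sum_apply]
  refine (Finset.abs_sum_le_sum_abs _ _).trans ?_
  refine (Finset.sum_le_card_nsmul _ _ N fun i _ => h3 i).trans_eq ?_
  rw [nsmul_eq_mul]

/-- The difference vanishes where |u| ≤ N and is at most |u| elsewhere, where |u|² ≤ N^{-(p-2)}
|u|ᵖ. -/
theorem norm_sub_truncation_sq_le {M : Type*} [MeasurableSpace M] {μ : Measure M}
    {p N : ℝ} (hp : 2 < p) (hN : 0 < N) (u t : Lp ℝ 2 μ)
    (hu : MemLp u (ENNReal.ofReal p) μ)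
    (ht : t =ᵐ[μ] fun x => max (-N) (min (u x) N)) :
    ‖u - t‖ ^ 2 ≤ N ^ (-(p - 2)) * (eLpNorm u (ENNReal.ofReal p) μ).toReal ^ p := by
  obtain ⟨h1, h2⟩ := integral_abs_rpow_eq (by linarith) _ hu
  rw [lp_norm_sq_eq, ← h2, ← integral_const_mul]
  refine integral_mono_ae (by simpa only [sq] using integrable_lp_mul (u - t) (u - t))
    (h1.const_mul _) ?_
  filter_upwards [ht, Lp.coeFn_sub u t] with x h3 h4
  rw [h4, Pi.sub_apply, h3]
  have h5 : |u x - max (-N) (min (u x) N)| ≤ |u x| ∧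
      (|u x| ≤ N → u x - max (-N) (min (u x) N) = 0) := by
    rcases le_total (u x) N with h | h
    · rw [min_eq_left h]
      rcases le_total (-N) (u x) with h' | h'
      · rw [max_eq_right h', sub_self]
        simp
      · rw [max_eq_left h']
        refine ⟨?_, fun hx => ?_⟩
        · rw [abs_of_nonpos (by linarith), abs_of_nonpos (by linarith)]
          linarith
        · linarith [(abs_le.1 hx).1]
    · rw [min_eq_right h, max_eq_right (by linarith)]
      refine ⟨?_, fun hx => ?_⟩
      · rw [abs_of_nonneg (by linarith), abs_of_nonneg (by linarith)]
        linarith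
      · linarith [(abs_le.1 hx).2]
  rcases le_total |u x| N with h | h
  · rw [h5.2 h, zero_pow two_ne_zero]
    positivity
  · have hux : 0 < |u x| := hN.trans_le h
    calc (u x - max (-N) (min (u x) N)) ^ 2 = |u x - max (-N) (min (u x) N)| ^ 2 := (sq_abs _).symm
      _ ≤ |u x| ^ 2 := pow_le_pow_left₀ (abs_nonneg _) h5.1 2
      _ = |u x| ^ (-(p - 2)) * |u x| ^ p := by
        rw [← Real.rpow_add hux, ← Real.rpow_two]
        congr 1
        ring
      _ ≤ N ^ (-(p - 2)) * |u x| ^ p := by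
        refine mul_le_mul_of_nonneg_right ?_ (by positivity)
        exact Real.rpow_le_rpow_of_nonpos hN h (by linarith)

/-! ### Brezis–Lieb splitting and the numerical dichotomy -/

/-- Convexity of the power at |s| + |t| = (1-τ)·|s|/(1-τ) + τ·|t|/τ, with τ chosen so that τ^{1-p} =
1 + ε. -/
theorem exists_abs_add_rpow_le {p : ℝ} (hp : 1 < p) {ε : ℝ} (hε : 0 < ε) :
    ∃ K : ℝ, ∀ s t : ℝ, |s + t| ^ p ≤ (1 + ε) * |t| ^ p + K * |s| ^ p := by
  set τ : ℝ := (1 + ε) ^ (-(1 / (p - 1))) with hτ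
  have hp1 : 0 < p - 1 := by linarith
  have hτ0 : 0 < τ := by positivity
  have hτ1 : τ < 1 := Real.rpow_lt_one_of_one_lt_of_neg (by linarith) (by
    rw [neg_lt_zero]; positivity)
  have h1τ : 0 < 1 - τ := by linarith
  have hτp : τ ^ (1 - p) = 1 + ε := by
    rw [hτ, ← Real.rpow_mul (by linarith), show -(1 / (p - 1)) * (1 - p) = 1 by field_simp; ring,
      Real.rpow_one]
  refine ⟨(1 - τ) ^ (1 - p), fun s t => ?_⟩
  have h := (convexOn_rpow hp.le).2 (x := |s| / (1 - τ)) (y := |t| / τ)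
    (Set.mem_Ici.2 (by positivity)) (Set.mem_Ici.2 (by positivity)) h1τ.le hτ0.le (by ring)
  simp only [smul_eq_mul] at h
  rw [mul_div_cancel₀ _ h1τ.ne', mul_div_cancel₀ _ hτ0.ne', Real.div_rpow (abs_nonneg _) h1τ.le,
    Real.div_rpow (abs_nonneg _) hτ0.le] at h
  have e : ∀ a : ℝ, 0 < a → ∀ b : ℝ, a * (b / a ^ p) = a ^ (1 - p) * b := fun a ha b => by
    rw [Real.rpow_sub ha, Real.rpow_one]
    field_simp
  rw [e _ h1τ, e _ hτ0, hτp] at h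
  calc |s + t| ^ p ≤ (|s| + |t|) ^ p :=
        Real.rpow_le_rpow (abs_nonneg _) (abs_add_le _ _) (by linarith)
    _ ≤ _ := h
    _ = _ := by ring

/-- One half of the Brezis–Lieb lemma. -/
theorem one_sub_integral_rpow_le {M : Type*} [MeasurableSpace M] {μ : Measure M} {p : ℝ}
    (hp : 1 < p) (u w : ℕ → M → ℝ) (v : M → ℝ) (b : ℕ → ℝ) (c : ℝ)
    (hu : ∀ n, Integrable (fun x => |u n x| ^ p) μ) (hu1 : ∀ n, ∫ x, |u n x| ^ p ∂μ = 1)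
    (hv : Integrable (fun x => |v x| ^ p) μ)
    (hw : ∀ n, Integrable (fun x => |w n x| ^ p) μ) (hwb : ∀ n, ∫ x, |w n x| ^ p ∂μ ≤ b n)
    (hb : Tendsto b atTop (𝓝 c)) (huw : ∀ n, ∀ᵐ x ∂μ, u n x = v x + w n x)
    (hlim : ∀ᵐ x ∂μ, Tendsto (fun n => u n x) atTop (𝓝 (v x))) :
    1 - ∫ x, |v x| ^ p ∂μ ≤ c := by
  have key : ∀ ε : ℝ, 0 < ε → 1 - ∫ x, |v x| ^ p ∂μ ≤ (1 + ε) * c := by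
    intro ε hε
    obtain ⟨K, hK⟩ := exists_abs_add_rpow_le hp hε
    -- Fatou: the integrand is nonnegative by the choice of K, and since w n → 0 almost everywhere
    -- its limit is (K - 1)|v|ᵖ. The terms in K cancel afterwards.
    have h := integrable_and_integral_le_of_tendsto
      (fun n x => (1 + ε) * |w n x| ^ p + K * |v x| ^ p - |u n x| ^ p)
      (fun x => K * |v x| ^ p - |v x| ^ p)
      (fun n => (1 + ε) * b n + K * ∫ x, |v x| ^ p ∂μ - 1)
      ((1 + ε) * c + K * ∫ x, |v x| ^ p ∂μ - 1)
      (fun n => (((hw n).const_mul _).add (hv.const_mul _)).sub (hu n))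
      (fun n => by
        filter_upwards [huw n] with x hx
        rw [hx]
        linarith [hK (v x) (w n x)])
      (by
        filter_upwards [hlim, ae_all_iff.2 huw] with x hx hx'
        have h0 : Tendsto (fun n => w n x) atTop (𝓝 0) := by
          have := hx.sub_const (v x)
          rw [sub_self] at this
          refine this.congr fun n => ?_
          rw [hx' n]
          ring
        have h1 := (h0.abs.rpow_const (p := p) (Or.inr (by linarith))).const_mul (1 + ε)
        have h2 := hx.abs.rpow_const (p := p) (Or.inr (by linarith))
        rw [abs_zero, Real.zero_rpow (by linarith), mul_zero] at h1
        simpa using (h1.add_const (K * |v x| ^ p)).sub h2)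
      (fun n => by
        have h1 : Integrable (fun x => (1 + ε) * |w n x| ^ p + K * |v x| ^ p) μ :=
          ((hw n).const_mul _).add (hv.const_mul _)
        rw [integral_sub h1 (hu n), hu1, integral_add ((hw n).const_mul _) (hv.const_mul _),
          integral_const_mul, integral_const_mul]
        have := mul_le_mul_of_nonneg_left (hwb n) (show 0 ≤ 1 + ε by linarith)
        linarith)
      (((hb.const_mul _).add_const _).sub_const _)
    have h2 := h.2
    rw [integral_sub (hv.const_mul _) hv, integral_const_mul] at h2
    linarith
  have hlim' : Tendsto (fun ε : ℝ => (1 + ε) * c) (𝓝[>] 0) (𝓝 ((1 + 0) * c)) :=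
    ((by fun_prop : Continuous fun ε : ℝ => (1 + ε) * c).tendsto 0).mono_left nhdsWithin_le_nhds
  have := ge_of_tendsto hlim' (by filter_upwards [self_mem_nhdsWithin] with ε hε using key ε hε)
  linarith

/-- Since s ≤ 1, one has 1 - a^s ≤ 1 - a ≤ (1-a)^s. If a < 1 then e > 0. For y ≥ 0 this gives e ≤
y(1-a)^s ≤ yAe < e; for y ≤ 0 it gives e ≤ y(1 - a^s) ≤ 0. -/
theorem eq_one_of_split {a e y A s : ℝ} (ha0 : 0 ≤ a) (ha1 : a ≤ 1) (hA : 0 < A) (hy : y < 1 / A)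
    (hs0 : 0 < s) (hs1 : s ≤ 1) (h1 : y * a ^ s + e ≤ y) (h2 : (1 - a) ^ s ≤ A * e) : a = 1 := by
  have hα : a ≤ a ^ s := by
    simpa using Real.rpow_le_rpow_of_exponent_ge_of_imp ha0 ha1 hs1 (by
      intro _ h; exact absurd h one_ne_zero)
  have hα1 : a ^ s ≤ 1 := Real.rpow_le_one ha0 ha1 hs0.le
  have hβ : 1 - a ≤ (1 - a) ^ s := by
    simpa using Real.rpow_le_rpow_of_exponent_ge_of_imp (by linarith : 0 ≤ 1 - a) (by linarith) hs1
      (by intro _ h; exact absurd h one_ne_zero)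
  have hyA : y * A < 1 := by rwa [lt_div_iff₀ hA] at hy
  by_contra hne
  have hβ0 : 0 < 1 - a := lt_of_le_of_ne (by linarith) fun h => hne (by linarith)
  have he : 0 < e := by
    by_contra! h
    nlinarith
  rcases le_total y 0 with h | h
  · nlinarith
  · have h3 : e ≤ y * (1 - a) ^ s := by nlinarith
    have h4 : A * e ≤ (y * A) * (1 - a) ^ s := by nlinarith
    nlinarith

/-! ### The form domain as a Hilbert space, and the resolvent -/

noncomputable section

namespace DirichletForm

variable {M : Type*} [MeasurableSpace M] {μ : Measure M} [IsFiniteMeasure μ]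

/-- The form domain, to be equipped with the inner product `𝓔(u, v) + ⟪u, v⟫`. -/
def FormSpace (E : DirichletForm μ) : Type _ := E.domain

namespace FormSpace

variable (E : DirichletForm μ)

instance : AddCommGroup (FormSpace E) := inferInstanceAs (AddCommGroup E.domain)

instance : Module ℝ (FormSpace E) := inferInstanceAs (Module ℝ E.domain)

/-- The identity, as a map from the form space to the form domain. -/
def toDomain : FormSpace E ≃ₗ[ℝ] E.domain := LinearEquiv.refl ℝ E.domain

/-- The inner product `𝓔(u, v) + ⟪u, v⟫`. -/
instance core : InnerProductSpace.Core ℝ (FormSpace E) where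
  inner u v := E.form (toDomain E u) (toDomain E v) + inner ℝ (toDomain E u) (toDomain E v)
  conj_inner_symm u v := by
    simp only [conj_trivial]
    rw [E.symm, real_inner_comm]
  re_inner_nonneg u := by
    simp only [RCLike.re_to_real]
    exact add_nonneg (E.nonneg _) real_inner_self_nonneg
  add_left u v w := by
    simp only [map_add, LinearMap.add_apply, inner_add_left]
    ring
  smul_left u v r := by
    simp only [map_smul, LinearMap.smul_apply, conj_trivial, smul_eq_mul]
    have h : inner ℝ (r • toDomain E u) (toDomain E v) =
        r * inner ℝ (toDomain E u) (toDomain E v) :=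
      real_inner_smul_left (toDomain E u : Lp ℝ 2 μ) (toDomain E v : Lp ℝ 2 μ) r
    rw [h]
    ring
  definite u hu := by
    have h1 := E.nonneg (toDomain E u)
    have h2 : 0 ≤ inner ℝ (toDomain E u) (toDomain E u) := real_inner_self_nonneg
    have h3 : inner ℝ (toDomain E u) (toDomain E u) = 0 := by
      change E.form (toDomain E u) (toDomain E u) + inner ℝ (toDomain E u) (toDomain E u) = 0 at hu
      linarith
    exact (toDomain E).map_eq_zero_iff.1 (inner_self_eq_zero.1 h3)

instance : NormedAddCommGroup (FormSpace E) :=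
  InnerProductSpace.Core.toNormedAddCommGroup (cd := core E)

instance : InnerProductSpace ℝ (FormSpace E) := InnerProductSpace.ofCore (core E).toCore

theorem inner_def (u v : FormSpace E) :
    inner ℝ u v = E.form (toDomain E u) (toDomain E v) +
      inner ℝ (toDomain E u) (toDomain E v) := rfl

theorem norm_sq (u : FormSpace E) :
    ‖u‖ ^ 2 = E.form (toDomain E u) (toDomain E u) + ‖toDomain E u‖ ^ 2 := by
  rw [← real_inner_self_eq_norm_sq, inner_def, real_inner_self_eq_norm_sq]

instance : CompleteSpace (FormSpace E) := by
  refine Metric.complete_of_cauchySeq_tendsto fun u hu => ?_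
  have h1 := (cauchySeq_iff_tendsto_dist_atTop_0.1 hu).pow 2
  obtain ⟨w, hw⟩ := E.closed (fun n => toDomain E (u n)) (by
    simp only [dist_eq_norm, norm_sq] at h1
    rwa [zero_pow two_ne_zero] at h1)
  refine ⟨(toDomain E).symm w, ?_⟩
  rw [tendsto_iff_norm_sub_tendsto_zero]
  have h2 : Tendsto (fun n => ‖u n - (toDomain E).symm w‖ ^ 2) atTop (𝓝 0) := by
    simpa only [norm_sq, map_sub, LinearEquiv.apply_symm_apply] using hw
  have h3 := h2.sqrt
  simpa only [Real.sqrt_sq (norm_nonneg _), Real.sqrt_zero] using h3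

/-- The inclusion of the form space into `L²`. -/
def toLp : FormSpace E →L[ℝ] Lp ℝ 2 μ :=
  LinearMap.mkContinuous (E.domain.subtype ∘ₗ (toDomain E).toLinearMap) 1 fun u => by
    rw [one_mul]
    change ‖toDomain E u‖ ≤ ‖u‖
    refine abs_le_of_sq_le_sq' ?_ (norm_nonneg _) |>.2
    rw [norm_sq]
    linarith [E.nonneg (toDomain E u)]

end FormSpace

open FormSpace

variable (E : DirichletForm μ)

/-- The resolvent `(1 + L)⁻¹` of the generator `L` of the form. -/
def resolvent : Lp ℝ 2 μ →ₗ[ℝ] E.domain :=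
  (toDomain E).toLinearMap ∘ₗ (ContinuousLinearMap.adjoint (toLp E)).toLinearMap

theorem form_resolvent_add_inner (f : Lp ℝ 2 μ) (w : E.domain) :
    E.form (E.resolvent f) w + inner ℝ (E.resolvent f : Lp ℝ 2 μ) (w : Lp ℝ 2 μ) =
      inner ℝ f (w : Lp ℝ 2 μ) :=
  ContinuousLinearMap.adjoint_inner_left (toLp E) ((toDomain E).symm w) f

theorem exists_subseq_tendsto_form (u : ℕ → E.domain) (R : ℝ)
    (hu : ∀ n, E.form (u n) (u n) + ‖u n‖ ^ 2 ≤ R) :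
    ∃ (v : E.domain) (φ : ℕ → ℕ), StrictMono φ ∧
      (∀ w, Tendsto (fun n => E.form (u (φ n)) w) atTop (𝓝 (E.form v w))) ∧
      ∀ f : Lp ℝ 2 μ, Tendsto (fun n => inner ℝ (u (φ n) : Lp ℝ 2 μ) f) atTop
        (𝓝 (inner ℝ (v : Lp ℝ 2 μ) f)) := by
  obtain ⟨v, φ, hφ, h⟩ := exists_subseq_tendsto_inner
    (fun n => (toDomain E).symm (u n)) (Real.sqrt R) (fun n => by
      refine Real.le_sqrt_of_sq_le ?_
      rw [norm_sq, LinearEquiv.apply_symm_apply]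
      exact hu n)
  have h1 : ∀ f : Lp ℝ 2 μ, Tendsto (fun n => inner ℝ (u (φ n) : Lp ℝ 2 μ) f) atTop
        (𝓝 (inner ℝ (toDomain E v : Lp ℝ 2 μ) f)) := by
    intro f
    -- Testing against the adjoint of the inclusion turns weak convergence in the form space into
    -- weak convergence in L².
    have h2 := h (ContinuousLinearMap.adjoint (toLp E) f)
    simp only [ContinuousLinearMap.adjoint_inner_right] at h2
    exact h2
  refine ⟨toDomain E v, φ, hφ, fun w => ?_, h1⟩
  have h3 := (h ((toDomain E).symm w)).sub (h1 (w : Lp ℝ 2 μ))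
  simp only [inner_def, LinearEquiv.apply_symm_apply] at h3
  simpa using h3

theorem form_add_self (u v : E.domain) :
    E.form (u + v) (u + v) = E.form u u + 2 * E.form u v + E.form v v := by
  simp only [map_add, LinearMap.add_apply]
  rw [E.symm v u]
  ring

theorem form_sub_self (u v : E.domain) :
    E.form (u - v) (u - v) = E.form u u - 2 * E.form u v + E.form v v := by
  simp only [map_sub, LinearMap.sub_apply]
  rw [E.symm v u]
  ring

theorem form_smul_self (c : ℝ) (u : E.domain) :
    E.form (c • u) (c • u) = c ^ 2 * E.form u u := by
  simp only [map_smul, LinearMap.smul_apply, smul_eq_mul]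
  ring

/-- With v the resolvent of u, testing with u - v gives ‖u - v‖² = 𝓔(v, u - v), and 𝓔(u - v) ≥ 0
bounds this by 𝓔(u). For the form c𝓔 the bound is c𝓔(u), so the resolvent approximates the identity
as c → 0. -/
theorem norm_sub_resolvent_sq_le (u : E.domain) :
    ‖u - E.resolvent (u : Lp ℝ 2 μ)‖ ^ 2 ≤ E.form u u := by
  set v := E.resolvent (u : Lp ℝ 2 μ)
  have h := E.form_resolvent_add_inner (u : Lp ℝ 2 μ) (u - v)
  change E.form v (u - v) + inner ℝ v (u - v) = inner ℝ u (u - v) at h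
  have h1 : inner ℝ (u - v) (u - v) = E.form v (u - v) := by
    rw [inner_sub_left]
    linarith
  rw [← real_inner_self_eq_norm_sq, h1]
  have h2 := E.nonneg (u - v)
  rw [form_sub_self] at h2
  rw [map_sub, E.symm v u]
  linarith [E.nonneg u, E.nonneg v]

/-! ### Consequences of the Markov property: truncations -/

/-- The hypothesis encodes a, b ≥ 0 with disjoint supports; contraction under |·| then reads 𝓔(a +
b) ≤ 𝓔(a - b). -/
theorem form_nonpos_of_disjoint (a b : E.domain)
    (h : |((a - b : E.domain) : Lp ℝ 2 μ)| = ((a + b : E.domain) : Lp ℝ 2 μ)) :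
    E.form a b ≤ 0 := by
  obtain ⟨w, hw, hle⟩ := E.abs_contraction (a - b)
  have : w = a + b := Subtype.ext (hw.trans h)
  rw [this, form_add_self, form_sub_self] at hle
  linarith

theorem exists_min_const (v : E.domain) (hv : 0 ≤ (v : Lp ℝ 2 μ)) (k : ℝ) (hk : 0 < k) :
    ∃ a : E.domain, ((a : Lp ℝ 2 μ) =ᵐ[μ] fun x => min ((v : Lp ℝ 2 μ) x) k) ∧
      E.form a a ≤ E.form v v := by
  have h0 : 0 ≤ ((k⁻¹ • v : E.domain) : Lp ℝ 2 μ) := by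
    rw [← Lp.coeFn_nonneg] at hv ⊢
    filter_upwards [hv, Lp.coeFn_smul k⁻¹ (v : Lp ℝ 2 μ)] with x h1 h2
    change 0 ≤ (k⁻¹ • (v : Lp ℝ 2 μ)) x
    rw [h2]
    exact mul_nonneg (inv_nonneg.2 hk.le) h1
  obtain ⟨w, hw, hle⟩ := E.unit_contraction (k⁻¹ • v) h0
  refine ⟨k • w, ?_, ?_⟩
  · have h1 := Lp.coeFn_smul k (w : Lp ℝ 2 μ)
    have h2 := Lp.coeFn_inf ((k⁻¹ • v : E.domain) : Lp ℝ 2 μ) (Lp.const 2 μ (1 : ℝ))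
    have h3 := Lp.coeFn_const (p := 2) (μ := μ) (1 : ℝ)
    have h4 := Lp.coeFn_smul k⁻¹ (v : Lp ℝ 2 μ)
    rw [← hw] at h2
    filter_upwards [h1, h2, h3, h4] with x h1 h2 h3 h4
    change (k • (w : Lp ℝ 2 μ)) x = _
    change (w : Lp ℝ 2 μ) x = min ((k⁻¹ • (v : Lp ℝ 2 μ)) x) (Lp.const 2 μ (1 : ℝ) x) at h2
    rw [h1, Pi.smul_apply, h2, h3, h4]
    simp only [Pi.smul_apply, smul_eq_mul, Function.const_apply]
    rw [mul_min_of_nonneg _ _ hk.le, mul_inv_cancel_left₀ hk.ne', mul_one]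
  · rw [form_smul_self] at hle ⊢
    calc k ^ 2 * E.form w w ≤ k ^ 2 * (k⁻¹ ^ 2 * E.form v v) := by gcongr
      _ = E.form v v := by field_simp

/-- For t > 0, cutting a + t(v - a) at height k gives a again, so 𝓔(a) ≤ 𝓔(a + t(v - a)). Dividing
by t and letting t → 0 yields the first-order condition. -/
theorem form_min_const_sub_nonneg (v a : E.domain) (hv : 0 ≤ (v : Lp ℝ 2 μ)) (k : ℝ) (hk : 0 < k)
    (ha : (a : Lp ℝ 2 μ) =ᵐ[μ] fun x => min ((v : Lp ℝ 2 μ) x) k) :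
    0 ≤ E.form a (v - a) := by
  have key : ∀ t : ℝ, 0 < t → 0 ≤ 2 * E.form a (v - a) + t * E.form (v - a) (v - a) := by
    intro t ht
    have hco : ((a + t • (v - a) : E.domain) : Lp ℝ 2 μ) =ᵐ[μ]
        fun x => (a : Lp ℝ 2 μ) x + t * ((v : Lp ℝ 2 μ) x - (a : Lp ℝ 2 μ) x) := by
      filter_upwards [Lp.coeFn_add (a : Lp ℝ 2 μ) (t • ((v : Lp ℝ 2 μ) - (a : Lp ℝ 2 μ))),
        Lp.coeFn_smul t ((v : Lp ℝ 2 μ) - (a : Lp ℝ 2 μ)),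
        Lp.coeFn_sub (v : Lp ℝ 2 μ) (a : Lp ℝ 2 μ)] with x h1 h2 h3
      change ((a : Lp ℝ 2 μ) + t • ((v : Lp ℝ 2 μ) - (a : Lp ℝ 2 μ))) x = _
      rw [h1, Pi.add_apply, h2, Pi.smul_apply, h3]
      rfl
    have hv' := (Lp.coeFn_nonneg _).2 hv
    have h0 : 0 ≤ ((a + t • (v - a) : E.domain) : Lp ℝ 2 μ) := by
      rw [← Lp.coeFn_nonneg]
      filter_upwards [hco, ha, hv'] with x h1 h2 h3
      rw [h1, h2]
      have h4 : 0 ≤ min ((v : Lp ℝ 2 μ) x) k := le_min h3 hk.le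
      have h5 : 0 ≤ (v : Lp ℝ 2 μ) x - min ((v : Lp ℝ 2 μ) x) k := sub_nonneg.2 (min_le_left _ _)
      change 0 ≤ _
      positivity
    obtain ⟨a', ha', hle⟩ := E.exists_min_const _ h0 k hk
    have haa : a' = a := by
      apply Subtype.ext
      apply Lp.ext
      filter_upwards [ha', hco, ha] with x h1 h2 h3
      rw [h1, h2, h3]
      rcases le_total ((v : Lp ℝ 2 μ) x) k with h | h
      · simp [min_eq_left h]
      · rw [min_eq_right h, min_eq_right]
        nlinarith
    rw [haa, form_add_self, form_smul_self, map_smul, smul_eq_mul] at hle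
    have h6 : 0 ≤ t * (2 * E.form a (v - a) + t * E.form (v - a) (v - a)) := by linarith
    exact nonneg_of_mul_nonneg_right h6 ht
  have hlim : Tendsto (fun t : ℝ => 2 * E.form a (v - a) + t * E.form (v - a) (v - a))
      (𝓝[>] 0) (𝓝 (2 * E.form a (v - a) + 0 * E.form (v - a) (v - a))) :=
    ((continuous_const.add (continuous_id.mul continuous_const)).tendsto 0).mono_left
      nhdsWithin_le_nhds
  have := ge_of_tendsto hlim (by filter_upwards [self_mem_nhdsWithin] with t ht using key t ht)
  linarith

theorem exists_posPart (u : E.domain) :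
    ∃ p q : E.domain, ((p : Lp ℝ 2 μ) =ᵐ[μ] fun x => max ((u : Lp ℝ 2 μ) x) 0) ∧
      ((q : Lp ℝ 2 μ) =ᵐ[μ] fun x => max (-(u : Lp ℝ 2 μ) x) 0) ∧ u = p - q ∧
      E.form p p + E.form q q ≤ E.form u u := by
  obtain ⟨w, hw, hle⟩ := E.abs_contraction u
  have hwx : (w : Lp ℝ 2 μ) =ᵐ[μ] fun x => |(u : Lp ℝ 2 μ) x| := by
    rw [hw]; exact Lp.coeFn_abs _
  refine ⟨(1 / 2 : ℝ) • (w + u), (1 / 2 : ℝ) • (w - u), ?_, ?_, by module, ?_⟩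
  · filter_upwards [Lp.coeFn_smul (1 / 2 : ℝ) ((w : Lp ℝ 2 μ) + (u : Lp ℝ 2 μ)),
      Lp.coeFn_add (w : Lp ℝ 2 μ) (u : Lp ℝ 2 μ), hwx] with x h1 h2 h3
    change ((1 / 2 : ℝ) • ((w : Lp ℝ 2 μ) + (u : Lp ℝ 2 μ))) x = _
    rw [h1, Pi.smul_apply, h2, Pi.add_apply, h3, smul_eq_mul]
    rcases le_total 0 ((u : Lp ℝ 2 μ) x) with h | h
    · rw [abs_of_nonneg h, max_eq_left h]; ring
    · rw [abs_of_nonpos h, max_eq_right h]; ring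
  · filter_upwards [Lp.coeFn_smul (1 / 2 : ℝ) ((w : Lp ℝ 2 μ) - (u : Lp ℝ 2 μ)),
      Lp.coeFn_sub (w : Lp ℝ 2 μ) (u : Lp ℝ 2 μ), hwx] with x h1 h2 h3
    change ((1 / 2 : ℝ) • ((w : Lp ℝ 2 μ) - (u : Lp ℝ 2 μ))) x = _
    rw [h1, Pi.smul_apply, h2, Pi.sub_apply, h3, smul_eq_mul]
    rcases le_total 0 ((u : Lp ℝ 2 μ) x) with h | h
    · rw [abs_of_nonneg h, max_eq_right (by linarith)]; ring
    · rw [abs_of_nonpos h, max_eq_left (by linarith)]; ring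
  · rw [form_smul_self, form_smul_self, form_add_self, form_sub_self]
    linarith

/-- Writing w = u⁺ - min(u⁺, k), one has 𝓔(u, w) = 𝓔(w) + 𝓔(min(u⁺, k), w) - 𝓔(u⁻, w): the middle
term is nonnegative by the first-order condition, and the last form value is nonpositive by
disjointness. This makes w a usable test function. -/
theorem exists_sub_const_posPart (u : E.domain) (k : ℝ) (hk : 0 < k) :
    ∃ w : E.domain, ((w : Lp ℝ 2 μ) =ᵐ[μ] fun x => max ((u : Lp ℝ 2 μ) x - k) 0) ∧
      E.form w w ≤ E.form u w := by
  obtain ⟨p, q, hp, hq, hpq, -⟩ := E.exists_posPart u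
  have hp0 : 0 ≤ (p : Lp ℝ 2 μ) := by
    rw [← Lp.coeFn_nonneg]
    filter_upwards [hp] with x h1
    rw [h1]
    exact le_max_right _ _
  obtain ⟨a, ha, -⟩ := E.exists_min_const p hp0 k hk
  have hsub := Lp.coeFn_sub (p : Lp ℝ 2 μ) (a : Lp ℝ 2 μ)
  have hw : ((p - a : E.domain) : Lp ℝ 2 μ) =ᵐ[μ] fun x => max ((u : Lp ℝ 2 μ) x - k) 0 := by
    filter_upwards [hsub, hp, ha] with x h1 h2 h3
    change ((p : Lp ℝ 2 μ) - (a : Lp ℝ 2 μ)) x = _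
    rw [h1, Pi.sub_apply, h3, h2]
    rcases le_total ((u : Lp ℝ 2 μ) x) 0 with h | h
    · rw [max_eq_right h, min_eq_left hk.le, max_eq_right (by linarith)]; ring
    · rw [max_eq_left h]
      rcases le_total ((u : Lp ℝ 2 μ) x) k with h' | h'
      · rw [min_eq_left h', max_eq_right (by linarith)]; ring
      · rw [min_eq_right h', max_eq_left (by linarith)]
  refine ⟨p - a, hw, ?_⟩
  have h1 := E.form_min_const_sub_nonneg p a hp0 k hk ha
  have h2 : E.form (p - a) q ≤ 0 := by
    refine E.form_nonpos_of_disjoint _ _ ?_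
    apply Lp.ext
    have e1 := Lp.coeFn_abs (((p - a : E.domain) : Lp ℝ 2 μ) - (q : Lp ℝ 2 μ))
    have e2 := Lp.coeFn_sub ((p - a : E.domain) : Lp ℝ 2 μ) (q : Lp ℝ 2 μ)
    have e3 := Lp.coeFn_add ((p - a : E.domain) : Lp ℝ 2 μ) (q : Lp ℝ 2 μ)
    filter_upwards [e1, e2, e3, hw, hq] with x e1 e2 e3 e4 e5
    change |((p - a : E.domain) : Lp ℝ 2 μ) - (q : Lp ℝ 2 μ)| x =
      (((p - a : E.domain) : Lp ℝ 2 μ) + (q : Lp ℝ 2 μ)) x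
    rw [e1, e2, e3, Pi.sub_apply, Pi.add_apply, e4, e5]
    rcases le_total ((u : Lp ℝ 2 μ) x) 0 with h | h
    · rw [max_eq_right (by linarith : (u : Lp ℝ 2 μ) x - k ≤ 0), max_eq_left (by linarith)]
      rw [abs_of_nonpos (by linarith)]; ring
    · rw [max_eq_right (by linarith : -(u : Lp ℝ 2 μ) x ≤ 0), sub_zero, add_zero]
      exact abs_of_nonneg (le_max_right _ _)
  have h3 : E.form u (p - a) = E.form (p - a) (p - a) + E.form a (p - a) - E.form (p - a) q := by
    rw [E.symm (p - a) q, ← LinearMap.add_apply, ← map_add, ← LinearMap.sub_apply, ← map_sub, hpq]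
    congr 2
    abel
  linarith

/-- The positive and negative parts are cut separately; the crude factor 2 comes from 𝓔(a - b) ≤
2𝓔(a) + 2𝓔(b) and suffices for total boundedness. -/
theorem exists_truncation (u : E.domain) (N : ℝ) (hN : 0 < N) :
    ∃ t : E.domain, ((t : Lp ℝ 2 μ) =ᵐ[μ] fun x => max (-N) (min ((u : Lp ℝ 2 μ) x) N)) ∧
      E.form t t ≤ 2 * E.form u u := by
  obtain ⟨p, q, hp, hq, -, hle⟩ := E.exists_posPart u
  have nn : ∀ (s : E.domain) (g : M → ℝ), ((s : Lp ℝ 2 μ) =ᵐ[μ] fun x => max (g x) 0) →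
      0 ≤ (s : Lp ℝ 2 μ) := by
    intro s g hs
    rw [← Lp.coeFn_nonneg]
    filter_upwards [hs] with x h1
    rw [h1]
    exact le_max_right _ _
  obtain ⟨a, ha, ha'⟩ := E.exists_min_const p (nn _ _ hp) N hN
  obtain ⟨b, hb, hb'⟩ := E.exists_min_const q (nn _ _ hq) N hN
  refine ⟨a - b, ?_, ?_⟩
  · filter_upwards [Lp.coeFn_sub (a : Lp ℝ 2 μ) (b : Lp ℝ 2 μ), ha, hb, hp, hq] with x h1 h2 h3 h4 h5
    change ((a : Lp ℝ 2 μ) - (b : Lp ℝ 2 μ)) x = _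
    rw [h1, Pi.sub_apply, h2, h3, h4, h5]
    rcases le_total ((u : Lp ℝ 2 μ) x) 0 with h | h
    · rw [max_eq_right h, min_eq_left hN.le, max_eq_left (by linarith), zero_sub,
        min_eq_left (by linarith : (u : Lp ℝ 2 μ) x ≤ N), max_comm]
      rcases le_total (-(u : Lp ℝ 2 μ) x) N with h' | h'
      · rw [min_eq_left h', max_eq_left (by linarith), neg_neg]
      · rw [min_eq_right h', max_eq_right (by linarith)]
    · rw [max_eq_left h, max_eq_right (by linarith : -(u : Lp ℝ 2 μ) x ≤ 0), min_eq_left hN.le,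
        sub_zero, max_eq_right]
      exact le_min (by linarith) (by linarith)
  · have h1 := E.nonneg (a + b)
    rw [form_add_self] at h1
    rw [form_sub_self]
    linarith

/-! ### Uniform smallness of the resolvent by De Giorgi iteration -/

/-- The form domain embeds in `Lᵖ`, with `‖v‖ₚ² ≤ C (𝓔(v) + ‖v‖₂²)`. -/
def SobolevBound (E : DirichletForm μ) (p C : ℝ) : Prop :=
  ∀ v : E.domain, MemLp (v : Lp ℝ 2 μ) (ENNReal.ofReal p) μ ∧
    (eLpNorm (v : Lp ℝ 2 μ) (ENNReal.ofReal p) μ).toReal ^ 2 ≤ C * (E.form v v + ‖v‖ ^ 2)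

theorem norm_resolvent_le (E : DirichletForm μ) (g : Lp ℝ 2 μ) : ‖E.resolvent g‖ ≤ ‖g‖ := by
  set u := E.resolvent g
  have h := E.form_resolvent_add_inner g u
  change E.form u u + inner ℝ u u = inner ℝ g (u : Lp ℝ 2 μ) at h
  rw [real_inner_self_eq_norm_sq] at h
  have h1 := real_inner_le_norm g (u : Lp ℝ 2 μ)
  change _ ≤ ‖g‖ * ‖u‖ at h1
  have h2 := E.nonneg u
  by_contra! h3
  nlinarith [norm_nonneg g, norm_nonneg u]

/-- Testing the resolvent equation with w = (u - k)⁺ gives 𝓔(w) + ‖w‖² ≤ ∫|w|. Hölder on {u > k} and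
the Sobolev bound, after dividing by ‖w‖ₚ, control ‖w‖ₚ; Chebyshev on {u > h} finishes. The gain is
that p - 1 > 1. -/
theorem level_set_estimate (E : DirichletForm μ) {p C : ℝ} (hp : 2 < p) (hC : 0 < C)
    (hE : E.SobolevBound p C) (g : Lp ℝ 2 μ) (hg : ∀ᵐ x ∂μ, |g x| ≤ 1) (k h : ℝ) (hk : 0 < k)
    (hkh : k < h) :
    (h - k) ^ p * μ.real {x | h < (E.resolvent g : Lp ℝ 2 μ) x} ≤
      C ^ p * μ.real {x | k < (E.resolvent g : Lp ℝ 2 μ) x} ^ (p - 1) := by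
  have hp0 : 0 < p := by linarith
  set u := E.resolvent g with hu
  obtain ⟨w, hw, hle⟩ := E.exists_sub_const_posPart u k hk
  obtain ⟨hwp, hwS⟩ := hE w
  set P := (eLpNorm (w : Lp ℝ 2 μ) (ENNReal.ofReal p) μ).toReal with hP
  have hP0 : 0 ≤ P := ENNReal.toReal_nonneg
  have hSm : MeasurableSet {x | k < (u : Lp ℝ 2 μ) x} :=
    measurableSet_lt measurable_const (Lp.stronglyMeasurable _).measurable
  have h1 : E.form w w + ‖w‖ ^ 2 ≤ ∫ x, |(w : Lp ℝ 2 μ) x| ∂μ := by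
    have e1 := E.form_resolvent_add_inner g w
    rw [← hu] at e1
    have e2 : ‖w‖ ^ 2 ≤ inner ℝ (u : Lp ℝ 2 μ) (w : Lp ℝ 2 μ) := by
      change ‖(w : Lp ℝ 2 μ)‖ ^ 2 ≤ _
      rw [← real_inner_self_eq_norm_sq, lp_inner_eq, lp_inner_eq]
      refine integral_mono_ae (integrable_lp_mul _ _) (integrable_lp_mul _ _) ?_
      filter_upwards [hw] with x hx
      rw [hx]
      rcases le_total ((u : Lp ℝ 2 μ) x - k) 0 with h | h
      · simp [max_eq_right h]
      · rw [max_eq_left h]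
        nlinarith
    have e3 : inner ℝ g (w : Lp ℝ 2 μ) ≤ ∫ x, |(w : Lp ℝ 2 μ) x| ∂μ := by
      rw [lp_inner_eq]
      refine integral_mono_ae (integrable_lp_mul _ _)
        ((Lp.memLp (w : Lp ℝ 2 μ)).integrable (by norm_num)).abs ?_
      filter_upwards [hg] with x hx
      calc g x * (w : Lp ℝ 2 μ) x ≤ |g x * (w : Lp ℝ 2 μ) x| := le_abs_self _
        _ = |g x| * |(w : Lp ℝ 2 μ) x| := abs_mul _ _
        _ ≤ 1 * |(w : Lp ℝ 2 μ) x| := by gcongr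
        _ = _ := one_mul _
    linarith
  have h2 := integral_abs_le_of_eq_zero_off hp _ hwp hSm (by
    filter_upwards [hw] with x hx hxS
    rw [hx, max_eq_right]
    simp only [not_lt] at hxS
    linarith)
  set φ := μ.real {x | k < (u : Lp ℝ 2 μ) x} with hφ
  have hφ0 : 0 ≤ φ := measureReal_nonneg
  have h3 : P ≤ C * φ ^ (1 - 1 / p) := by
    have e : P ^ 2 ≤ C * (P * φ ^ (1 - 1 / p)) := hwS.trans (by gcongr; exact h1.trans h2)
    by_contra! hcon
    have h0 : 0 ≤ C * φ ^ (1 - 1 / p) := by positivity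
    nlinarith
  have h4 := rpow_mul_measureReal_le hp0 _ hwp (h - k) (by linarith)
  have h5 : μ.real {x | h < (u : Lp ℝ 2 μ) x} ≤ μ.real {x | h - k ≤ |(w : Lp ℝ 2 μ) x|} := by
    refine ENNReal.toReal_mono (measure_ne_top _ _) (measure_mono_ae ?_)
    filter_upwards [hw] with x hx hxh
    change h < (u : Lp ℝ 2 μ) x at hxh
    change h - k ≤ |(w : Lp ℝ 2 μ) x|
    rw [hx]
    exact (by linarith : h - k ≤ (u : Lp ℝ 2 μ) x - k).trans
      ((le_max_left _ _).trans (le_abs_self _))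
  calc (h - k) ^ p * μ.real {x | h < (u : Lp ℝ 2 μ) x}
      ≤ (h - k) ^ p * μ.real {x | h - k ≤ |(w : Lp ℝ 2 μ) x|} := by
        gcongr
    _ ≤ P ^ p := h4
    _ ≤ (C * φ ^ (1 - 1 / p)) ^ p := by gcongr
    _ = C ^ p * φ ^ (p - 1) := by
      rw [Real.mul_rpow hC.le (by positivity), ← Real.rpow_mul hφ0]
      congr 2
      field_simp

theorem exists_resolvent_le (E : DirichletForm μ) {p C : ℝ} (hp : 2 < p) (hC : 0 < C)
    (hE : E.SobolevBound p C) (η : ℝ) (hη : 0 < η) :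
    ∃ δ : ℝ, 0 < δ ∧ ∀ g : Lp ℝ 2 μ, (∀ᵐ x ∂μ, |g x| ≤ 1) → ‖g‖ ≤ δ →
      ∀ᵐ x ∂μ, (E.resolvent g : Lp ℝ 2 μ) x ≤ η := by
  have hp0 : 0 < p := by linarith
  -- The levels rise from η/2 to η with gaps (η/4)·2⁻ʲ, hence the constants (4C/η)ᵖ and 2ᵖ; the
  -- excess exponent is (p - 1) - 1. Chebyshev in L² at level η/2 makes the first level set small.
  obtain ⟨δ, hδ, hy⟩ := exists_forall_tendsto_zero_of_le_geometric_mul_rpow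
    ((4 * C / η) ^ p) (2 ^ p) (p - 2) (by positivity)
    (Real.one_lt_rpow (by norm_num) hp0) (by linarith)
  refine ⟨η / 2 * Real.sqrt δ, by positivity, fun g hg hgδ => ?_⟩
  set u := E.resolvent g with hu
  set φ : ℝ → ℝ := fun t => μ.real {x | t < (u : Lp ℝ 2 μ) x} with hφ
  have hanti : ∀ s t, s ≤ t → φ t ≤ φ s := fun s t hst =>
    measureReal_mono fun x hx => lt_of_le_of_lt hst hx
  set l : ℕ → ℝ := fun j => η * (1 - (1 / 2) ^ (j + 1)) with hl
  have hl0 : ∀ j, 0 < l j := fun j => by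
    have : ((1 : ℝ) / 2) ^ (j + 1) < 1 := pow_lt_one₀ (by norm_num) (by norm_num) (by omega)
    simp only [hl]
    exact mul_pos hη (by linarith)
  have hlη : ∀ j, l j ≤ η := fun j => by
    have : 0 < ((1 : ℝ) / 2) ^ (j + 1) := by positivity
    simp only [hl]
    nlinarith
  have hd : ∀ j, l (j + 1) - l j = η / 4 * (1 / 2) ^ j := fun j => by
    simp only [hl, pow_succ]
    ring
  have hlim := hy (fun j => φ (l j)) (fun j => measureReal_nonneg) (fun j => by
    have hpos : 0 < l (j + 1) - l j := by rw [hd]; positivity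
    have h := E.level_set_estimate hp hC hE g hg (l j) (l (j + 1)) (hl0 j) (by linarith)
    change (l (j + 1) - l j) ^ p * φ (l (j + 1)) ≤ C ^ p * φ (l j) ^ (p - 1) at h
    rw [← le_div_iff₀' (by positivity)] at h
    refine h.trans_eq ?_
    have e : C ^ p / (l (j + 1) - l j) ^ p = (4 * C / η) ^ p * (2 ^ p) ^ j := by
      rw [← Real.div_rpow hC.le hpos.le, ← Real.rpow_natCast (2 ^ p) j, ← Real.rpow_mul (by norm_num),
        mul_comm p, Real.rpow_mul (by norm_num), Real.rpow_natCast,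
        ← Real.mul_rpow (by positivity) (by positivity), hd]
      congr 1
      rw [div_pow, one_pow]
      field_simp
    rw [mul_div_right_comm, e]
    congr 2
    ring) (by
    have h2 := rpow_mul_measureReal_le (μ := μ) (p := 2) (by norm_num) (u : Lp ℝ 2 μ)
      (by simpa using Lp.memLp (u : Lp ℝ 2 μ)) (η / 2) (by positivity)
    have h3 : (eLpNorm (u : Lp ℝ 2 μ) (ENNReal.ofReal 2) μ).toReal = ‖u‖ := by
      rw [ENNReal.ofReal_ofNat]
      exact (Lp.norm_def _).symm
    rw [h3, Real.rpow_two, Real.rpow_two] at h2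
    have h4 : φ (l 0) ≤ μ.real {x | η / 2 ≤ |(u : Lp ℝ 2 μ) x|} := by
      refine measureReal_mono fun x hx => ?_
      have hx' : l 0 < (u : Lp ℝ 2 μ) x := hx
      have : l 0 = η / 2 := by simp only [hl]; ring
      exact (this ▸ hx'.le).trans (le_abs_self _)
    have h5 : ‖u‖ ^ 2 ≤ (η / 2) ^ 2 * δ := by
      calc ‖u‖ ^ 2 ≤ (η / 2 * Real.sqrt δ) ^ 2 := by
            gcongr
            exact (E.norm_resolvent_le g).trans hgδ
        _ = _ := by rw [mul_pow, Real.sq_sqrt hδ.le]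
    have h6 := h2.trans h5
    exact h4.trans (le_of_mul_le_mul_left h6 (by positivity)))
  have hz : φ η ≤ 0 := ge_of_tendsto' hlim fun j => hanti _ _ (hlη j)
  have hz' : μ {x | η < (u : Lp ℝ 2 μ) x} = 0 := by
    have h0 : φ η = 0 := le_antisymm hz measureReal_nonneg
    simpa [hφ, measureReal_eq_zero_iff] using h0
  rw [ae_iff]
  simpa using hz'

theorem exists_abs_resolvent_le (E : DirichletForm μ) {p C : ℝ} (hp : 2 < p) (hC : 0 < C)
    (hE : E.SobolevBound p C) (η : ℝ) (hη : 0 < η) :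
    ∃ δ : ℝ, 0 < δ ∧ ∀ g : Lp ℝ 2 μ, (∀ᵐ x ∂μ, |g x| ≤ 1) → ‖g‖ ≤ δ →
      ∀ᵐ x ∂μ, |(E.resolvent g : Lp ℝ 2 μ) x| ≤ η := by
  obtain ⟨δ, hδ, h⟩ := E.exists_resolvent_le hp hC hE η hη
  refine ⟨δ, hδ, fun g hg hgδ => ?_⟩
  have h1 := h g hg hgδ
  have h2 := h (-g) (by
    filter_upwards [hg, Lp.coeFn_neg g] with x hx hn
    rw [hn, Pi.neg_apply, abs_neg]
    exact hx) (by rwa [norm_neg])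
  rw [map_neg] at h2
  filter_upwards [h1, h2, Lp.coeFn_neg (E.resolvent g : Lp ℝ 2 μ)] with x h1 h2 h3
  change (-(E.resolvent g : Lp ℝ 2 μ)) x ≤ η at h2
  rw [h3, Pi.neg_apply] at h2
  exact abs_le.2 ⟨by linarith, h1⟩

/-! ### Compactness of the embedding into L² -/

theorem ae_le_of_tendsto_inner (f : ℕ → Lp ℝ 2 μ) (g : Lp ℝ 2 μ) (N : ℝ)
    (hf : ∀ n, ∀ᵐ x ∂μ, f n x ≤ N)
    (hg : ∀ h, Tendsto (fun n => inner ℝ (f n) h) atTop (𝓝 (inner ℝ g h))) :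
    ∀ᵐ x ∂μ, g x ≤ N := by
  have hint : ∀ u : Lp ℝ 2 μ, Integrable u μ := fun u => (Lp.memLp u).integrable (by norm_num)
  refine ae_le_of_forall_setIntegral_le (g := fun _ => N) (hint g) (integrable_const _)
    fun s hs hμs => ?_
  have h := hg (indicatorConstLp 2 hs hμs.ne (1 : ℝ))
  have e : ∀ u : Lp ℝ 2 μ, inner ℝ u (indicatorConstLp 2 hs hμs.ne (1 : ℝ)) = ∫ x in s, u x ∂μ :=
    fun u => by
      rw [real_inner_comm]
      exact L2.inner_indicatorConstLp_one hs hμs.ne u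
  simp only [e] at h
  refine le_of_tendsto' h fun n => ?_
  refine setIntegral_mono_ae (hint _).integrableOn (integrable_const _).integrableOn (hf n)

theorem ae_abs_le_of_tendsto_inner (f : ℕ → Lp ℝ 2 μ) (g : Lp ℝ 2 μ) (N : ℝ)
    (hf : ∀ n, ∀ᵐ x ∂μ, |f n x| ≤ N)
    (hg : ∀ h, Tendsto (fun n => inner ℝ (f n) h) atTop (𝓝 (inner ℝ g h))) :
    ∀ᵐ x ∂μ, |g x| ≤ N := by
  have h1 := ae_le_of_tendsto_inner f g N
    (fun n => (hf n).mono fun x hx => (le_abs_self _).trans hx) hg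
  have h2 := ae_le_of_tendsto_inner (fun n => -f n) (-g) N
    (fun n => by
      filter_upwards [hf n, Lp.coeFn_neg (f n)] with x hx h
      rw [h, Pi.neg_apply]
      exact (neg_le_abs _).trans hx)
    (fun h => by
      simp only [inner_neg_left]
      exact (hg h).neg)
  filter_upwards [h1, h2, Lp.coeFn_neg g] with x h1 h2 h3
  rw [h3, Pi.neg_apply] at h2
  exact abs_le.2 ⟨by linarith, h1⟩

theorem resolvent_smul_sum_ae_eq (E : DirichletForm μ) (z : ℕ → Lp ℝ 2 μ) (F : Finset ℕ) (c : ℝ) :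
    ∀ᵐ x ∂μ, (E.resolvent (c • ∑ i ∈ F, z i) : Lp ℝ 2 μ) x =
      c * ∑ i ∈ F, (E.resolvent (z i) : Lp ℝ 2 μ) x := by
  rw [map_smul, map_sum]
  have h1 := Lp.coeFn_smul c ((∑ i ∈ F, E.resolvent (z i) : E.domain) : Lp ℝ 2 μ)
  have h2 := Lp.coeFn_finsetSum F (fun i => (E.resolvent (z i) : Lp ℝ 2 μ))
  filter_upwards [h1, h2] with x h1 h2
  change (c • ((∑ i ∈ F, E.resolvent (z i) : E.domain) : Lp ℝ 2 μ)) x = _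
  rw [h1, Pi.smul_apply, smul_eq_mul, Submodule.coe_sum, h2]
  simp

/-- If |(1+L)⁻¹ z n| ≥ ε at x for infinitely many n, with one sign, then m of these indices can be
picked so that (mN)⁻¹ ∑ z i is bounded by 1 and small in L². Its resolvent is then uniformly small,
yet at x it has modulus at least ε/N. -/
theorem ae_tendsto_resolvent_zero (E : DirichletForm μ) {p C : ℝ} (hp : 2 < p) (hC : 0 < C)
    (hE : E.SobolevBound p C) (z : ℕ → Lp ℝ 2 μ) (N K : ℝ) (hN : 0 < N)
    (hz : ∀ n, ∀ᵐ x ∂μ, |z n x| ≤ N) (hK : ∀ n, ‖z n‖ ≤ K)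
    (hw : ∀ h, Tendsto (fun n => inner ℝ (z n) h) atTop (𝓝 0)) :
    ∀ᵐ x ∂μ, Tendsto (fun n => (E.resolvent (z n) : Lp ℝ 2 μ) x) atTop (𝓝 0) := by
  have hη : ∀ j : ℕ, (0 : ℝ) < 1 / ((j : ℝ) + 1) := fun j => by positivity
  choose δ hδ hJ using fun j : ℕ => E.exists_abs_resolvent_le hp hC hE _ (hη j)
  -- There are only countably many F and j, so one null set serves every choice; F may then depend
  -- on x.
  have h1 : ∀ᵐ x ∂μ, ∀ F : Finset ℕ, ∀ j : ℕ,
      ‖((F.card * N)⁻¹ • ∑ i ∈ F, z i : Lp ℝ 2 μ)‖ ≤ δ j →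
      |(F.card * N)⁻¹ * ∑ i ∈ F, (E.resolvent (z i) : Lp ℝ 2 μ) x| ≤ 1 / ((j : ℝ) + 1) := by
    rw [ae_all_iff]
    intro F
    rw [ae_all_iff]
    intro j
    by_cases hF : ‖((F.card * N)⁻¹ • ∑ i ∈ F, z i : Lp ℝ 2 μ)‖ ≤ δ j
    · have h2 := ae_abs_smul_sum_le z N hz F (F.card * N)⁻¹ (by positivity) (inv_mul_le_one)
      filter_upwards [hJ j _ h2 hF, E.resolvent_smul_sum_ae_eq z F (F.card * N)⁻¹] with x h3 h4 _
      rwa [← h4]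
    · exact Eventually.of_forall fun x h => absurd h hF
  filter_upwards [h1] with x hx
  set a : ℕ → ℝ := fun n => (E.resolvent (z n) : Lp ℝ 2 μ) x with ha
  have key : ∀ s : ℝ, |s| = 1 → ∀ ε : ℝ, 0 < ε → ∀ᶠ n in atTop, s * a n < ε := by
    intro s hs ε hε
    by_contra hcon
    have hI : {n | ε ≤ s * a n}.Infinite := by
      rw [← Nat.frequently_atTop_iff_infinite]
      simpa only [not_eventually, not_lt] using hcon
    obtain ⟨j, hj⟩ := exists_nat_one_div_lt (show 0 < ε / N by positivity)
    obtain ⟨m, hm⟩ := exists_nat_gt ((K ^ 2 + 1) / (N ^ 2 * δ j ^ 2))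
    have hδj := hδ j
    have hm0 : (0 : ℝ) < m := lt_of_le_of_lt (by positivity) hm
    obtain ⟨F, hFI, hFm, hFn⟩ := exists_finset_norm_sum_sq_le z K hK hw _ hI m
    have h2 : ‖((F.card * N)⁻¹ • ∑ i ∈ F, z i : Lp ℝ 2 μ)‖ ≤ δ j := by
      rw [hFm]
      refine abs_le_of_sq_le_sq' ?_ (hδ j).le |>.2
      rw [norm_smul, mul_pow, Real.norm_of_nonneg (by positivity)]
      rw [div_lt_iff₀ (by positivity)] at hm
      calc ((m : ℝ) * N)⁻¹ ^ 2 * ‖∑ i ∈ F, z i‖ ^ 2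
          ≤ ((m : ℝ) * N)⁻¹ ^ 2 * (m * (m * (N ^ 2 * δ j ^ 2))) := by
            gcongr
            exact hFn.trans (by gcongr)
        _ = δ j ^ 2 := by field_simp
    have h3 := hx F j h2
    have h4 : (m : ℝ) * ε ≤ ∑ i ∈ F, s * a i := by
      have := Finset.card_nsmul_le_sum F (fun i => s * a i) ε fun i hi => hFI hi
      rwa [nsmul_eq_mul, hFm] at this
    have h5 : ε / N ≤ |(F.card * N)⁻¹ * ∑ i ∈ F, a i| := by
      calc ε / N = (m * N)⁻¹ * (m * ε) := by field_simp
        _ ≤ (m * N)⁻¹ * ∑ i ∈ F, s * a i := by gcongr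
        _ = s * ((F.card * N)⁻¹ * ∑ i ∈ F, a i) := by rw [← Finset.mul_sum, hFm]; ring
        _ ≤ |s * ((F.card * N)⁻¹ * ∑ i ∈ F, a i)| := le_abs_self _
        _ = _ := by rw [abs_mul, hs, one_mul]
    linarith
  rw [Metric.tendsto_atTop']
  refine fun ε hε => ?_
  have h2 := (key 1 (by simp) ε hε).and (key (-1) (by simp) ε hε)
  obtain ⟨n, hn⟩ := eventually_atTop.1 h2
  refine ⟨n, fun k hk => ?_⟩
  rw [Real.dist_eq, sub_zero, abs_lt]
  obtain ⟨h3, h4⟩ := hn k hk.le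
  exact ⟨by linarith, by linarith⟩

theorem tendsto_resolvent_zero (E : DirichletForm μ) {p C : ℝ} (hp : 2 < p) (hC : 0 < C)
    (hE : E.SobolevBound p C) (z : ℕ → Lp ℝ 2 μ) (N K : ℝ) (hN : 0 < N)
    (hz : ∀ n, ∀ᵐ x ∂μ, |z n x| ≤ N) (hK : ∀ n, ‖z n‖ ≤ K)
    (hw : ∀ h, Tendsto (fun n => inner ℝ (z n) h) atTop (𝓝 0)) :
    Tendsto (fun n => ‖E.resolvent (z n)‖) atTop (𝓝 0) := by
  have h1 := E.ae_tendsto_resolvent_zero hp hC hE z N K hN hz hK hw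
  have hK0 : 0 ≤ K := (norm_nonneg _).trans (hK 0)
  obtain ⟨δ, hδ, hJ⟩ := E.exists_abs_resolvent_le hp hC hE 1 one_pos
  -- Scaling by t brings every z n into the range of the uniform bound, so 1/t dominates all
  -- resolvents.
  set t : ℝ := min N⁻¹ (δ / (K + 1)) with ht
  have ht0 : 0 < t := lt_min (by positivity) (by positivity)
  have hbd : ∀ n, ∀ᵐ x ∂μ, |(E.resolvent (z n) : Lp ℝ 2 μ) x| ≤ 1 / t := by
    intro n
    have h2 := hJ (t • z n) (by
      filter_upwards [hz n, Lp.coeFn_smul t (z n)] with x h3 h4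
      rw [h4, Pi.smul_apply, smul_eq_mul, abs_mul, abs_of_pos ht0]
      calc t * |z n x| ≤ N⁻¹ * N := by gcongr; exact min_le_left _ _
        _ = 1 := inv_mul_cancel₀ hN.ne') (by
      rw [norm_smul, Real.norm_of_nonneg ht0.le]
      calc t * ‖z n‖ ≤ δ / (K + 1) * (K + 1) := by
            gcongr
            · exact min_le_right _ _
            · linarith [hK n]
        _ = δ := by field_simp)
    rw [map_smul] at h2
    filter_upwards [h2, Lp.coeFn_smul t (E.resolvent (z n) : Lp ℝ 2 μ)] with x h3 h4
    change |(t • (E.resolvent (z n) : Lp ℝ 2 μ)) x| ≤ 1 at h3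
    rw [h4, Pi.smul_apply, smul_eq_mul, abs_mul, abs_of_pos ht0] at h3
    rwa [le_div_iff₀' ht0]
  have h2 : Tendsto (fun n => ∫ x, (E.resolvent (z n) : Lp ℝ 2 μ) x ^ 2 ∂μ) atTop
      (𝓝 (∫ _, (0 : ℝ) ∂μ)) := by
    refine tendsto_integral_of_dominated_convergence (fun _ => (1 / t) ^ 2)
      (fun n => ((Lp.stronglyMeasurable _).pow 2).aestronglyMeasurable) (integrable_const _)
      (fun n => ?_) ?_
    · filter_upwards [hbd n] with x hx
      rw [norm_pow]
      exact pow_le_pow_left₀ (norm_nonneg _) hx 2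
    · filter_upwards [h1] with x hx
      simpa using hx.pow 2
  rw [integral_zero] at h2
  have h3 := h2.sqrt
  rw [Real.sqrt_zero] at h3
  refine h3.congr fun n => ?_
  rw [← lp_norm_sq_eq, Real.sqrt_sq (norm_nonneg _)]
  rfl

theorem isCompact_resolvent_image (E : DirichletForm μ) {p C : ℝ} (hp : 2 < p) (hC : 0 < C)
    (hE : E.SobolevBound p C) (N : ℝ) (hN : 0 < N) :
    IsCompact ((fun f : Lp ℝ 2 μ => (E.resolvent f : Lp ℝ 2 μ)) ''
      {f | ∀ᵐ x ∂μ, |f x| ≤ N}) := by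
  refine IsSeqCompact.isCompact fun u hu => ?_
  choose f hf hfu using hu
  obtain ⟨R, hR⟩ : ∃ R : ℝ, ∀ n, ‖f n‖ ≤ R :=
    ⟨_, fun n => Lp.norm_le_of_ae_bound hN.le (hf n)⟩
  obtain ⟨g, φ, hφ, hg⟩ := exists_subseq_tendsto_inner f R hR
  have hgN := ae_abs_le_of_tendsto_inner (fun n => f (φ n)) g N (fun n => hf _) hg
  refine ⟨_, ⟨g, hgN, rfl⟩, φ, hφ, ?_⟩
  have h := E.tendsto_resolvent_zero hp hC hE (fun n => f (φ n) - g) (2 * N) (R + ‖g‖)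
    (by positivity) (fun n => by
      filter_upwards [hf (φ n), hgN, Lp.coeFn_sub (f (φ n)) g] with x h1 h2 h3
      rw [h3, Pi.sub_apply]
      exact (abs_sub _ _).trans (by linarith))
    (fun n => (norm_sub_le _ _).trans (by linarith [hR (φ n)]))
    (fun h => by
      simp only [inner_sub_left]
      simpa using (hg h).sub_const (inner ℝ g h))
  rw [tendsto_iff_norm_sub_tendsto_zero]
  refine h.congr fun n => ?_
  rw [map_sub, Function.comp_apply, ← hfu]
  rfl

/-- The Dirichlet form `c 𝓔`. -/
def scale (E : DirichletForm μ) (c : ℝ) (hc : 0 < c) : DirichletForm μ where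
  domain := E.domain
  form := c • E.form
  dense_domain := E.dense_domain
  symm u v := by
    simp only [LinearMap.smul_apply]
    rw [E.symm]
  nonneg v := by
    simp only [LinearMap.smul_apply, smul_eq_mul]
    exact mul_nonneg hc.le (E.nonneg v)
  closed u hu := by
    have hle : ∀ v : E.domain, E.form v v + ‖v‖ ^ 2 ≤
        (1 + c⁻¹) * ((c • E.form) v v + ‖v‖ ^ 2) := fun v => by
      simp only [LinearMap.smul_apply, smul_eq_mul]
      have h1 := E.nonneg v
      have h2 : c⁻¹ * (c * E.form v v) = E.form v v := inv_mul_cancel_left₀ hc.ne' _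
      have h3 : 0 ≤ c * E.form v v := by positivity
      have h4 : 0 ≤ c⁻¹ * ‖v‖ ^ 2 := by positivity
      linarith
    have hle' : ∀ v : E.domain, (c • E.form) v v + ‖v‖ ^ 2 ≤
        (1 + c) * (E.form v v + ‖v‖ ^ 2) := fun v => by
      simp only [LinearMap.smul_apply, smul_eq_mul]
      have h1 := E.nonneg v
      have h4 : 0 ≤ c * ‖v‖ ^ 2 := by positivity
      linarith
    obtain ⟨w, hw⟩ := E.closed u (squeeze_zero
      (fun _ => add_nonneg (E.nonneg _) (by positivity)) (fun _ => hle _)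
      (by simpa using hu.const_mul (1 + c⁻¹)))
    refine ⟨w, squeeze_zero (fun _ => ?_) (fun _ => hle' _) (by simpa using hw.const_mul (1 + c))⟩
    simp only [LinearMap.smul_apply, smul_eq_mul]
    exact add_nonneg (mul_nonneg hc.le (E.nonneg _)) (by positivity)
  abs_contraction v := by
    obtain ⟨w, hw, hle⟩ := E.abs_contraction v
    refine ⟨w, hw, ?_⟩
    simp only [LinearMap.smul_apply, smul_eq_mul]
    gcongr
  unit_contraction v hv := by
    obtain ⟨w, hw, hle⟩ := E.unit_contraction v hv
    refine ⟨w, hw, ?_⟩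
    simp only [LinearMap.smul_apply, smul_eq_mul]
    gcongr

theorem SobolevBound.scale {E : DirichletForm μ} {p C : ℝ} (hC : 0 < C) (hE : E.SobolevBound p C)
    (c : ℝ) (hc : 0 < c) : (E.scale c hc).SobolevBound p (C * (1 + c⁻¹)) := by
  intro v
  refine ⟨(hE v).1, (hE v).2.trans ?_⟩
  rw [mul_assoc]
  refine mul_le_mul_of_nonneg_left ?_ hC.le
  change E.form v v + ‖v‖ ^ 2 ≤ (1 + c⁻¹) * (c * E.form v v + ‖v‖ ^ 2)
  have h1 : 0 ≤ E.form v v := E.nonneg v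
  have h2 : c⁻¹ * (c * E.form v v) = E.form v v := inv_mul_cancel_left₀ hc.ne' _
  have h3 : 0 ≤ c * E.form v v := by positivity
  have h4 : 0 ≤ c⁻¹ * ‖v‖ ^ 2 := by positivity
  linarith

theorem totallyBounded_form_ball (E : DirichletForm μ) {p C : ℝ} (hp : 2 < p) (hC : 0 < C)
    (hE : E.SobolevBound p C) (R : ℝ) (hR : 0 < R) :
    TotallyBounded {f : Lp ℝ 2 μ | ∃ u : E.domain, (u : Lp ℝ 2 μ) = f ∧
      E.form u u + ‖u‖ ^ 2 ≤ R} := by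
  rw [Metric.totallyBounded_iff]
  intro ε hε
  -- Truncations have energy at most 2R, so the resolvent of c𝓔 moves them by at most ε/4.
  -- Truncating costs another ε/4, and so does the finite net.
  set c : ℝ := (ε / 4) ^ 2 / (2 * R) with hc
  have hc0 : 0 < c := by positivity
  obtain ⟨N, hN0, hN⟩ : ∃ N : ℝ, 0 < N ∧ N ^ (-(p - 2)) * (C * R) ^ (p / 2) ≤ (ε / 4) ^ 2 := by
    have h := (tendsto_rpow_neg_atTop (show 0 < p - 2 by linarith)).mul_const ((C * R) ^ (p / 2))
    rw [zero_mul] at h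
    obtain ⟨N, h1, h2⟩ := ((eventually_gt_atTop 0).and
      (h.eventually (gt_mem_nhds (show 0 < (ε / 4) ^ 2 by positivity)))).exists
    exact ⟨N, h1, h2.le⟩
  have hcpt := (E.scale c hc0).isCompact_resolvent_image hp (by positivity)
    (SobolevBound.scale hC hE c hc0) N hN0
  obtain ⟨T, hT, hcov⟩ := Metric.totallyBounded_iff.1 hcpt.totallyBounded (ε / 4) (by positivity)
  refine ⟨T, hT, ?_⟩
  rintro _ ⟨u, rfl, hu⟩
  obtain ⟨t, ht, hle⟩ := E.exists_truncation u N hN0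
  have h1 : ‖(u : Lp ℝ 2 μ) - t‖ ≤ ε / 4 := by
    refine abs_le_of_sq_le_sq' ?_ (by positivity) |>.2
    refine (norm_sub_truncation_sq_le hp hN0 _ _ (hE u).1 ht).trans (le_trans ?_ hN)
    refine mul_le_mul_of_nonneg_left ?_ (by positivity)
    set P := (eLpNorm (u : Lp ℝ 2 μ) (ENNReal.ofReal p) μ).toReal
    have hP0 : 0 ≤ P := ENNReal.toReal_nonneg
    calc P ^ p = (P ^ 2) ^ (p / 2) := by
          rw [← Real.rpow_two, ← Real.rpow_mul hP0]
          congr 1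
          ring
      _ ≤ (C * R) ^ (p / 2) := by
          refine Real.rpow_le_rpow (by positivity) ?_ (by linarith)
          exact (hE u).2.trans (by gcongr)
  have h2 : ‖(t : Lp ℝ 2 μ) - ((E.scale c hc0).resolvent (t : Lp ℝ 2 μ) : Lp ℝ 2 μ)‖ ≤ ε / 4 := by
    refine abs_le_of_sq_le_sq' ?_ (by positivity) |>.2
    refine ((E.scale c hc0).norm_sub_resolvent_sq_le t).trans ?_
    change c * E.form t t ≤ _
    have h3 : E.form t t ≤ 2 * R := by linarith [sq_nonneg ‖u‖]
    calc c * E.form t t ≤ c * (2 * R) := by gcongr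
      _ = (ε / 4) ^ 2 := by rw [hc]; field_simp
  have h3 : ((E.scale c hc0).resolvent (t : Lp ℝ 2 μ) : Lp ℝ 2 μ) ∈
      (fun f : Lp ℝ 2 μ => ((E.scale c hc0).resolvent f : Lp ℝ 2 μ)) ''
        {f | ∀ᵐ x ∂μ, |f x| ≤ N} := by
    refine ⟨_, ?_, rfl⟩
    filter_upwards [ht] with x hx
    rw [hx]
    exact abs_le.2 ⟨le_max_left _ _, max_le (by linarith) (min_le_right _ _)⟩
  obtain ⟨y, hy, hyt⟩ := Set.mem_iUnion₂.1 (hcov h3)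
  refine Set.mem_iUnion₂.2 ⟨y, hy, ?_⟩
  rw [Metric.mem_ball, dist_eq_norm] at hyt ⊢
  set r := ((E.scale c hc0).resolvent (t : Lp ℝ 2 μ) : Lp ℝ 2 μ)
  have h4 : (u : Lp ℝ 2 μ) - y = ((u : Lp ℝ 2 μ) - t) + ((t : Lp ℝ 2 μ) - r) + (r - y) := by abel
  rw [h4]
  have h5 := norm_add₃_le (a := (u : Lp ℝ 2 μ) - t) (b := (t : Lp ℝ 2 μ) - r) (c := r - y)
  linarith

/-- A Sobolev inequality makes the embedding of the form domain into `L²` compact. -/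
theorem tendsto_norm_zero_of_tendsto_inner (E : DirichletForm μ) {p C : ℝ} (hp : 2 < p)
    (hC : 0 < C) (hE : E.SobolevBound p C) (w : ℕ → E.domain) (R : ℝ)
    (hR : ∀ n, E.form (w n) (w n) + ‖w n‖ ^ 2 ≤ R)
    (hw : ∀ f : Lp ℝ 2 μ, Tendsto (fun n => inner ℝ (w n : Lp ℝ 2 μ) f) atTop (𝓝 0)) :
    Tendsto (fun n => ‖w n‖) atTop (𝓝 0) := by
  have hR0 : 0 ≤ R := (add_nonneg (E.nonneg _) (by positivity)).trans (hR 0)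
  -- The radius must be positive, and R may be 0.
  have htb := E.totallyBounded_form_ball hp hC hE (R + 1) (by linarith)
  have hcpt := (htb.closure.isCompact_of_isClosed isClosed_closure).isSeqCompact
  refine tendsto_of_subseq_tendsto fun ns hns => ?_
  obtain ⟨g, -, φ, hφ, hg⟩ := hcpt (x := fun n => (w (ns n) : Lp ℝ 2 μ))
    fun n => subset_closure ⟨w (ns n), rfl, by linarith [hR (ns n)]⟩
  have h1 := (hw g).comp (hns.comp hφ.tendsto_atTop)
  have h2 : Tendsto (fun n => inner ℝ (w (ns (φ n)) : Lp ℝ 2 μ) g) atTop (𝓝 (inner ℝ g g)) :=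
    hg.inner tendsto_const_nhds
  have h3 : g = 0 := inner_self_eq_zero.1 (tendsto_nhds_unique h2 h1)
  refine ⟨φ, ?_⟩
  rw [h3] at hg
  simpa using hg.norm

/-! ### Limits and lower bounds for the Schrödinger energy -/

theorem coeFn_domain_sub (E : DirichletForm μ) (u v : E.domain) :
    ((u - v : E.domain) : Lp ℝ 2 μ) =ᵐ[μ] fun x => (u : Lp ℝ 2 μ) x - (v : Lp ℝ 2 μ) x :=
  Lp.coeFn_sub (u : Lp ℝ 2 μ) (v : Lp ℝ 2 μ)

theorem coeFn_domain_smul (E : DirichletForm μ) (c : ℝ) (v : E.domain) :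
    ((c • v : E.domain) : Lp ℝ 2 μ) =ᵐ[μ] fun x => c * (v : Lp ℝ 2 μ) x :=
  Lp.coeFn_smul c (v : Lp ℝ 2 μ)

/-- The number e is the energy lost in the weak limit: 𝓔(u - v) = 𝓔(u) - 2𝓔(u, v) + 𝓔(v), where the
cross term converges weakly and 𝓔(u) along a further subsequence. -/
theorem exists_subseq_tendsto (E : DirichletForm μ) {p C : ℝ} (hp : 2 < p) (hC : 0 < C)
    (hE : E.SobolevBound p C) (u : ℕ → E.domain) (R : ℝ)
    (hR : ∀ n, E.form (u n) (u n) + ‖u n‖ ^ 2 ≤ R) :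
    ∃ (v : E.domain) (φ : ℕ → ℕ) (e : ℝ), StrictMono φ ∧ 0 ≤ e ∧
      Tendsto (fun n => E.form (u (φ n)) (u (φ n))) atTop (𝓝 (E.form v v + e)) ∧
      Tendsto (fun n => E.form (u (φ n) - v) (u (φ n) - v)) atTop (𝓝 e) ∧
      Tendsto (fun n => ‖u (φ n) - v‖) atTop (𝓝 0) ∧
      ∀ᵐ x ∂μ, Tendsto (fun n => (u (φ n) : Lp ℝ 2 μ) x) atTop (𝓝 ((v : Lp ℝ 2 μ) x)) := by
  obtain ⟨v, φ, hφ, hform, hinner⟩ := E.exists_subseq_tendsto_form u R hR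
  have hnorm : Tendsto (fun n => ‖u (φ n) - v‖) atTop (𝓝 0) := by
    refine E.tendsto_norm_zero_of_tendsto_inner hp hC hE (fun n => u (φ n) - v)
      (2 * R + 2 * (E.form v v + ‖v‖ ^ 2)) (fun n => ?_) (fun f => ?_)
    · have h1 := E.nonneg (u (φ n) + v)
      have h2 := parallelogram_law_with_norm ℝ (u (φ n) : Lp ℝ 2 μ) (v : Lp ℝ 2 μ)
      change ‖u (φ n) + v‖ ^ 2 + ‖u (φ n) - v‖ ^ 2 =
        2 * (‖u (φ n)‖ ^ 2 + ‖v‖ ^ 2) at h2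
      have h3 := hR (φ n)
      rw [form_add_self] at h1
      rw [form_sub_self]
      nlinarith [sq_nonneg ‖u (φ n) + v‖]
    · have h1 := (hinner f).sub_const (inner ℝ (v : Lp ℝ 2 μ) f)
      rw [sub_self] at h1
      refine h1.congr fun n => ?_
      rw [← inner_sub_left]
      rfl
  have hLp : Tendsto (fun n => (u (φ n) : Lp ℝ 2 μ)) atTop (𝓝 (v : Lp ℝ 2 μ)) :=
    tendsto_iff_norm_sub_tendsto_zero.2 hnorm
  obtain ⟨ψ, hψ, hae⟩ := (tendstoInMeasure_of_tendsto_Lp hLp).exists_seq_tendsto_ae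
  obtain ⟨l, -, χ, hχ, hl⟩ := (isCompact_Icc (a := (0 : ℝ)) (b := R)).tendsto_subseq
    (x := fun n => E.form (u (φ (ψ n))) (u (φ (ψ n))))
    fun n => ⟨E.nonneg _, by linarith [hR (φ (ψ n)), sq_nonneg ‖u (φ (ψ n))‖]⟩
  have hχψ : Tendsto (fun n => ψ (χ n)) atTop atTop := hψ.tendsto_atTop.comp hχ.tendsto_atTop
  have hsub : Tendsto (fun n => E.form (u (φ (ψ (χ n))) - v) (u (φ (ψ (χ n))) - v)) atTop
      (𝓝 (l - E.form v v)) := by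
    have h1 := (hl.sub (((hform v).comp hχψ).const_mul 2)).add_const (E.form v v)
    rw [show l - 2 * E.form v v + E.form v v = l - E.form v v by ring] at h1
    refine h1.congr fun n => ?_
    rw [form_sub_self]
    rfl
  refine ⟨v, fun n => φ (ψ (χ n)), l - E.form v v, hφ.comp (hψ.comp hχ), ?_, ?_, hsub,
    hnorm.comp hχψ, ?_⟩
  · exact ge_of_tendsto' hsub fun n => E.nonneg _
  · rw [add_sub_cancel]
    exact hl
  · filter_upwards [hae] with x hx
    exact hx.comp hχ.tendsto_atTop

theorem norm_le_of_eLpNorm_eq_one {p : ℝ} (hp : 2 < p) :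
    ∃ K : ℝ, 0 ≤ K ∧ ∀ v : Lp ℝ 2 μ, eLpNorm v (ENNReal.ofReal p) μ = 1 → ‖v‖ ≤ K := by
  refine ⟨(μ Set.univ ^ (1 / (2 : ENNReal).toReal - 1 / (ENNReal.ofReal p).toReal)).toReal,
    ENNReal.toReal_nonneg, fun v hv => ?_⟩
  have h := eLpNorm_le_eLpNorm_mul_rpow_measure_univ (μ := μ) (p := 2) (q := ENNReal.ofReal p)
    (by
      rw [← ENNReal.ofReal_ofNat]
      exact ENNReal.ofReal_le_ofReal hp.le) (Lp.memLp v).1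
  rw [hv, one_mul] at h
  rw [Lp.norm_def]
  refine ENNReal.toReal_mono (ENNReal.rpow_ne_top_of_nonneg ?_ (measure_ne_top _ _)) h
  rw [ENNReal.toReal_ofReal (by linarith), ENNReal.toReal_ofNat, sub_nonneg]
  exact one_div_le_one_div_of_le (by norm_num) hp.le

theorem schrodingerEnergy_smul (E : DirichletForm μ) (V : M → ℝ) (v : E.domain)
    (hv : v ∈ E.schrodingerDomain V) (c : ℝ) :
    c • v ∈ E.schrodingerDomain V ∧
      E.schrodingerEnergy V (c • v) = c ^ 2 * E.schrodingerEnergy V v := by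
  have h : (fun x => V x * ((c • v : E.domain) : Lp ℝ 2 μ) x ^ 2) =ᵐ[μ]
      fun x => c ^ 2 * (V x * (v : Lp ℝ 2 μ) x ^ 2) := by
    filter_upwards [E.coeFn_domain_smul c v] with x hx
    rw [hx]
    ring
  refine ⟨(Integrable.const_mul hv (c ^ 2)).congr h.symm, ?_⟩
  rw [schrodingerEnergy, schrodingerEnergy, energy, energy, integral_congr_ae h,
    integral_const_mul, form_smul_self]
  ring

theorem mul_rpow_le_schrodingerEnergy (E : DirichletForm μ) {p : ℝ} (hp : 2 < p) (V : M → ℝ)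
    (y : ℝ) (hy : ∀ v ∈ E.schrodingerDomain V,
      eLpNorm (v : Lp ℝ 2 μ) (ENNReal.ofReal p) μ = 1 → y ≤ E.schrodingerEnergy V v)
    (v : E.domain) (hv : v ∈ E.schrodingerDomain V)
    (hvp : MemLp (v : Lp ℝ 2 μ) (ENNReal.ofReal p) μ) :
    y * (eLpNorm (v : Lp ℝ 2 μ) (ENNReal.ofReal p) μ).toReal ^ 2 ≤ E.schrodingerEnergy V v := by
  set P := (eLpNorm (v : Lp ℝ 2 μ) (ENNReal.ofReal p) μ).toReal with hP
  rcases (ENNReal.toReal_nonneg : 0 ≤ P).eq_or_lt with h | h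
  · have h0 : eLpNorm (v : Lp ℝ 2 μ) (ENNReal.ofReal p) μ = 0 :=
      ((ENNReal.toReal_eq_zero_iff _).1 h.symm).resolve_right hvp.2.ne
    rw [eLpNorm_eq_zero_iff hvp.1 (by simp; linarith)] at h0
    have h1 : v = (0 : ℝ) • v := by
      rw [zero_smul]
      exact Subtype.ext (Lp.eq_zero_iff_ae_eq_zero.2 h0)
    rw [h1, (E.schrodingerEnergy_smul V v hv 0).2, hP, ← h]
    simp
  · obtain ⟨h1, h2⟩ := E.schrodingerEnergy_smul V v hv P⁻¹
    have h3 : eLpNorm ((P⁻¹ • v : E.domain) : Lp ℝ 2 μ) (ENNReal.ofReal p) μ = 1 := by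
      have e : ((P⁻¹ • v : E.domain) : Lp ℝ 2 μ) =ᵐ[μ] P⁻¹ • (v : Lp ℝ 2 μ) :=
        Lp.coeFn_smul P⁻¹ (v : Lp ℝ 2 μ)
      rw [eLpNorm_congr_ae e, eLpNorm_const_smul, ← ENNReal.toReal_eq_one_iff, ENNReal.toReal_mul,
        ← hP, toReal_enorm, Real.norm_of_nonneg (by positivity), inv_mul_cancel₀ h.ne']
    have h4 := hy _ h1 h3
    rw [h2, inv_pow, inv_mul_eq_div, le_div_iff₀ (by positivity)] at h4
    exact h4

theorem integral_neg_part_le (E : DirichletForm μ) (W : M → ℝ) (hW : ∀ x, 0 ≤ W x)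
    (hWi : ∀ v : E.domain, Integrable (fun x => W x * (v : Lp ℝ 2 μ) x ^ 2) μ)
    (u v : E.domain) (δ : ℝ) (hδ : 0 < δ) :
    ∫ x, W x * (u : Lp ℝ 2 μ) x ^ 2 ∂μ ≤ (1 + δ) * ∫ x, W x * (v : Lp ℝ 2 μ) x ^ 2 ∂μ +
      (1 + δ⁻¹) * ∫ x, W x * ((u - v : E.domain) : Lp ℝ 2 μ) x ^ 2 ∂μ := by
  rw [← integral_const_mul, ← integral_const_mul,
    ← integral_add ((hWi v).const_mul _) ((hWi (u - v)).const_mul _)]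
  refine integral_mono_ae (hWi u) (((hWi v).const_mul _).add ((hWi (u - v)).const_mul _)) ?_
  filter_upwards [E.coeFn_domain_sub u v] with x hx
  rw [hx]
  set a := (u : Lp ℝ 2 μ) x
  set b := (v : Lp ℝ 2 μ) x
  have h1 : (1 + δ) * b ^ 2 + (1 + δ⁻¹) * (a - b) ^ 2 - a ^ 2 = δ⁻¹ * (δ * b - (a - b)) ^ 2 := by
    field_simp
    ring
  have h2 : 0 ≤ δ⁻¹ * (δ * b - (a - b)) ^ 2 := by positivity
  nlinarith [hW x]

/-- Fatou handles V + W = V₊. For W = V₋ the error sits in ∫ W (u n - v)², where the form bound may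
be taken with arbitrarily small coefficient on the energy e and ‖u n - v‖ → 0 removes the rest. -/
theorem schrodingerEnergy_add_le_of_tendsto (E : DirichletForm μ) (V : M → ℝ)
    (hVneg : E.InfinitesimallyFormBounded (fun x => max 0 (-V x)))
    (u : ℕ → E.domain) (v : E.domain) (y e : ℝ)
    (hu : ∀ n, u n ∈ E.schrodingerDomain V)
    (hy : Tendsto (fun n => E.schrodingerEnergy V (u n)) atTop (𝓝 y))
    (hform : Tendsto (fun n => E.form (u n) (u n)) atTop (𝓝 (E.form v v + e)))
    (hsub : Tendsto (fun n => E.form (u n - v) (u n - v)) atTop (𝓝 e))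
    (hnorm : Tendsto (fun n => ‖u n - v‖) atTop (𝓝 0))
    (hae : ∀ᵐ x ∂μ, Tendsto (fun n => (u n : Lp ℝ 2 μ) x) atTop (𝓝 ((v : Lp ℝ 2 μ) x))) :
    v ∈ E.schrodingerDomain V ∧ E.schrodingerEnergy V v + e ≤ y := by
  set W : M → ℝ := fun x => max 0 (-V x) with hW
  have hVW : ∀ x t, (V x + W x) * t = V x * t + W x * t := fun x t => add_mul _ _ _
  have hpos : ∀ x, 0 ≤ V x + W x := fun x => by
    linarith [le_max_right 0 (-V x), show W x = max 0 (-V x) from rfl]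
  have hWi : ∀ z : E.domain, Integrable (fun x => W x * (z : Lp ℝ 2 μ) x ^ 2) μ :=
    fun z => ((hVneg 1 one_pos).choose_spec z).1
  set I := ∫ x, W x * (v : Lp ℝ 2 μ) x ^ 2 ∂μ with hI
  have key : ∀ δ : ℝ, 0 < δ → Integrable (fun x => (V x + W x) * (v : Lp ℝ 2 μ) x ^ 2) μ ∧
      ∫ x, (V x + W x) * (v : Lp ℝ 2 μ) x ^ 2 ∂μ ≤
        y - (E.form v v + e) + ((1 + δ) * I + (1 + δ⁻¹) * (δ ^ 2 * e)) := by
    intro δ hδ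
    -- The choice δ² compensates the factor 1 + δ⁻¹ from the quadratic splitting: (1 + δ⁻¹)δ² = δ² +
    -- δ → 0.
    obtain ⟨c, hc⟩ := hVneg (δ ^ 2) (by positivity)
    refine integrable_and_integral_le_of_tendsto
      (fun n x => (V x + W x) * (u n : Lp ℝ 2 μ) x ^ 2) _
      (fun n => E.schrodingerEnergy V (u n) - E.form (u n) (u n) + ((1 + δ) * I + (1 + δ⁻¹) *
        (δ ^ 2 * E.form (u n - v) (u n - v) + c * ‖u n - v‖ ^ 2))) _
      (fun n => ?_) (fun n => ?_) ?_ (fun n => ?_) ?_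
    · simp only [hVW]
      exact Integrable.add (hu n) (hWi _)
    · exact Eventually.of_forall fun x => mul_nonneg (hpos x) (sq_nonneg _)
    · filter_upwards [hae] with x hx
      exact (hx.pow 2).const_mul _
    · simp only [hVW]
      rw [integral_add (hu n) (hWi _)]
      have h1 := E.integral_neg_part_le W (fun x => le_max_left _ _) hWi (u n) v δ hδ
      have h2 := (hc (u n - v)).2
      have h3 : 0 ≤ 1 + δ⁻¹ := by positivity
      have h4 := mul_le_mul_of_nonneg_left h2 h3
      simp only [schrodingerEnergy, energy] at h4 ⊢
      linarith
    · have h1 := (hsub.const_mul (δ ^ 2)).add ((hnorm.pow 2).const_mul c)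
      rw [zero_pow two_ne_zero, mul_zero, add_zero] at h1
      exact (hy.sub hform).add ((h1.const_mul _).const_add _)
  have hint := (key 1 one_pos).1
  have hlim : Tendsto (fun δ : ℝ => y - (E.form v v + e) + ((1 + δ) * I + (δ ^ 2 + δ) * e))
      (𝓝[>] 0) (𝓝 (y - (E.form v v + e) + ((1 + 0) * I + (0 ^ 2 + 0) * e))) :=
    ((by fun_prop : Continuous fun δ : ℝ =>
      y - (E.form v v + e) + ((1 + δ) * I + (δ ^ 2 + δ) * e)).tendsto 0).mono_left
        nhdsWithin_le_nhds
  have hle := ge_of_tendsto hlim (by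
    filter_upwards [self_mem_nhdsWithin] with δ hδ
    have hδ' : (0 : ℝ) < δ := hδ
    have h1 := (key δ hδ').2
    have h2 : (1 + δ⁻¹) * (δ ^ 2 * e) = (δ ^ 2 + δ) * e := by
      field_simp
    rwa [h2] at h1)
  have hdom : Integrable (fun x => V x * (v : Lp ℝ 2 μ) x ^ 2) μ := by
    refine (hint.sub (hWi v)).congr (Eventually.of_forall fun x => ?_)
    simp only [Pi.sub_apply]
    ring
  refine ⟨hdom, ?_⟩
  simp only [hVW] at hle
  rw [integral_add hdom (hWi v)] at hle
  rw [schrodingerEnergy, energy]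
  linarith

theorem half_energy_le_schrodingerEnergy (E : DirichletForm μ) (V : M → ℝ)
    (hVneg : E.InfinitesimallyFormBounded (fun x => max 0 (-V x))) :
    ∃ c : ℝ, 0 ≤ c ∧ ∀ v ∈ E.schrodingerDomain V,
      1 / 2 * E.form v v - c * ‖v‖ ^ 2 ≤ E.schrodingerEnergy V v := by
  obtain ⟨c, hc⟩ := hVneg (1 / 2) (by norm_num)
  refine ⟨|c|, abs_nonneg c, fun v hv => ?_⟩
  obtain ⟨h1, h2⟩ := hc v
  have h3 : -∫ x, max 0 (-V x) * (v : Lp ℝ 2 μ) x ^ 2 ∂μ ≤ ∫ x, V x * (v : Lp ℝ 2 μ) x ^ 2 ∂μ := by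
    rw [← integral_neg]
    refine integral_mono h1.neg hv fun x => ?_
    have := le_max_right 0 (-V x)
    simp only
    nlinarith [sq_nonneg ((v : Lp ℝ 2 μ) x)]
  have h4 : c * ‖v‖ ^ 2 ≤ |c| * ‖v‖ ^ 2 := by
    gcongr
    exact le_abs_self c
  rw [schrodingerEnergy]
  simp only [energy] at h2 ⊢
  linarith

/-- The lower bound m excludes the value -∞, and the strict upper bound excludes +∞, that is, an
empty constraint set. -/
theorem exists_minimizing_sequence (E : DirichletForm μ) (ν : ℝ) (V : M → ℝ) (m A : ℝ)
    (hm : ∀ v ∈ E.schrodingerDomain V, eLpNorm (v : Lp ℝ 2 μ) (sobolevExponent ν) μ = 1 →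
      m ≤ E.schrodingerEnergy V v)
    (hY : E.yamabeInvariant ν V < (A : EReal)) :
    ∃ y : ℝ, E.yamabeInvariant ν V = y ∧
      (∀ v ∈ E.schrodingerDomain V, eLpNorm (v : Lp ℝ 2 μ) (sobolevExponent ν) μ = 1 →
        y ≤ E.schrodingerEnergy V v) ∧
      ∃ u : ℕ → E.domain, (∀ n, u n ∈ E.schrodingerDomain V) ∧
        (∀ n, eLpNorm (u n : Lp ℝ 2 μ) (sobolevExponent ν) μ = 1) ∧
        (∀ n, E.schrodingerEnergy V (u n) ≤ y + 1) ∧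
        Tendsto (fun n => E.schrodingerEnergy V (u n)) atTop (𝓝 y) := by
  have hbot : (m : EReal) ≤ E.yamabeInvariant ν V :=
    le_iInf₂ fun v hv => EReal.coe_le_coe_iff.2 (hm v hv.1 hv.2)
  obtain ⟨y, hy⟩ : ∃ y : ℝ, E.yamabeInvariant ν V = y :=
    ⟨_, (EReal.coe_toReal hY.ne_top (ne_bot_of_le_ne_bot (EReal.coe_ne_bot m) hbot)).symm⟩
  have hle : ∀ v ∈ E.schrodingerDomain V, eLpNorm (v : Lp ℝ 2 μ) (sobolevExponent ν) μ = 1 →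
      y ≤ E.schrodingerEnergy V v := fun v h1 h2 => by
    rw [← EReal.coe_le_coe_iff, ← hy]
    exact iInf₂_le v ⟨h1, h2⟩
  have hex : ∀ n : ℕ, ∃ v : E.domain, (v ∈ E.schrodingerDomain V ∧
      eLpNorm (v : Lp ℝ 2 μ) (sobolevExponent ν) μ = 1) ∧
        E.schrodingerEnergy V v < y + 1 / ((n : ℝ) + 1) := fun n => by
    have h : E.yamabeInvariant ν V < ((y + 1 / ((n : ℝ) + 1) : ℝ) : EReal) := by
      rw [hy, EReal.coe_lt_coe_iff]
      have : (0 : ℝ) < 1 / ((n : ℝ) + 1) := by positivity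
      linarith
    rw [yamabeInvariant, iInf_lt_iff] at h
    obtain ⟨v, h⟩ := h
    rw [iInf_lt_iff] at h
    obtain ⟨hv, h⟩ := h
    exact ⟨v, hv, EReal.coe_lt_coe_iff.1 h⟩
  choose u hu hlt using hex
  refine ⟨y, hy, hle, u, fun n => (hu n).1, fun n => (hu n).2, fun n => (hlt n).le.trans ?_, ?_⟩
  · have : 1 / ((n : ℝ) + 1) ≤ 1 := by
      rw [div_le_one (by positivity)]
      linarith [(Nat.cast_nonneg n : (0 : ℝ) ≤ n)]
    linarith
  · refine tendsto_of_tendsto_of_tendsto_of_le_of_le tendsto_const_nhds ?_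
      (fun n => hle _ (hu n).1 (hu n).2) (fun n => (hlt n).le)
    simpa using tendsto_one_div_add_atTop_nhds_zero_nat.const_add y

theorem SobolevInequality.sobolevBound {E : DirichletForm μ} {ν A B : ℝ}
    (h : E.SobolevInequality ν A B) : E.SobolevBound (2 * ν / (ν - 2)) (max A B) := by
  intro v
  refine ⟨(h v).1, (h v).2.trans ?_⟩
  rw [mul_add]
  exact add_le_add (mul_le_mul_of_nonneg_right (le_max_left _ _) (E.nonneg v))
    (mul_le_mul_of_nonneg_right (le_max_right _ _) (by positivity))

end DirichletForm

end

/-! ### Existence of the minimizer -/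

theorem mainTheorem1 {M : Type*} [MeasurableSpace M] (μ : Measure M) [IsFiniteMeasure μ]
    (E : DirichletForm μ) (ν A B : ℝ) (hν : 2 < ν) (hA : 0 < A) (hB : 0 < B)
    (hSob : E.SobolevInequality ν A B)
    (V : M → ℝ) (hV : Integrable V μ)
    (hVneg : E.InfinitesimallyFormBounded (fun x => max 0 (-V x)))
    (hY : E.yamabeInvariant ν V < ((1 / A : ℝ) : EReal)) :
    ∃ v : E.domain, v ∈ E.schrodingerDomain V ∧
      (E.schrodingerEnergy V v : EReal) = E.yamabeInvariant ν V ∧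
      eLpNorm (v : Lp ℝ 2 μ) (sobolevExponent ν) μ = 1 := by
  set p : ℝ := 2 * ν / (ν - 2) with hpdef
  have hp : 2 < p := by
    rw [hpdef, lt_div_iff₀ (by linarith)]
    linarith
  have hp0 : 0 < p := by linarith
  have hexp : sobolevExponent ν = ENNReal.ofReal p := rfl
  have hC : 0 < max A B := lt_max_of_lt_left hA
  have hbd : E.SobolevBound p (max A B) := hSob.sobolevBound
  obtain ⟨c, hc0, hc⟩ := E.half_energy_le_schrodingerEnergy V hVneg
  obtain ⟨K, hK0, hK⟩ := DirichletForm.norm_le_of_eLpNorm_eq_one (μ := μ) hp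
  have hnormle : ∀ v : E.domain, eLpNorm (v : Lp ℝ 2 μ) (ENNReal.ofReal p) μ = 1 →
      ‖v‖ ^ 2 ≤ K ^ 2 := fun v hv => pow_le_pow_left₀ (norm_nonneg _) (hK _ hv) 2
  obtain ⟨y, hy, hmin, u, hu, hu1, hule, hulim⟩ :=
    E.exists_minimizing_sequence ν V (-(c * K ^ 2)) (1 / A) (fun v h1 h2 => by
      have h3 := hc v h1
      have h4 := mul_le_mul_of_nonneg_left (hnormle v h2) hc0
      linarith [E.nonneg v]) hY
  rw [hy, EReal.coe_lt_coe_iff] at hY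
  obtain ⟨v, φ, e, hφ, he, hform, hsub, hnorm, hae⟩ := E.exists_subseq_tendsto hp hC hbd u
    -- Coercivity with coefficient 1/2 and 𝓔_V(u n) ≤ y + 1 bound the energy by the first term; K²
    -- bounds ‖u n‖².
    (2 * (y + 1 + c * K ^ 2) + K ^ 2) (fun n => by
      have h3 := hc _ (hu n)
      have h4 := mul_le_mul_of_nonneg_left (hnormle _ (hu1 n)) hc0
      linarith [hule n, hnormle _ (hu1 n)])
  obtain ⟨hvdom, hvle⟩ := E.schrodingerEnergy_add_le_of_tendsto V hVneg (fun n => u (φ n)) v y e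
    (fun n => hu _) (hulim.comp hφ.tendsto_atTop) hform hsub hnorm hae
  have hLp : ∀ z : E.domain, MemLp (z : Lp ℝ 2 μ) (ENNReal.ofReal p) μ := fun z => (hbd z).1
  have hint := fun z : E.domain => (integral_abs_rpow_eq hp0 _ (hLp z)).1
  have hval := fun z : E.domain => (integral_abs_rpow_eq hp0 _ (hLp z)).2
  have huone : ∀ n, ∫ x, |(u n : Lp ℝ 2 μ) x| ^ p ∂μ = 1 := fun n => by
    rw [hval, ← hexp, hu1, ENNReal.toReal_one, Real.one_rpow]
  set a := ∫ x, |(v : Lp ℝ 2 μ) x| ^ p ∂μ with ha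
  set P := (eLpNorm (v : Lp ℝ 2 μ) (ENNReal.ofReal p) μ).toReal with hP
  have hP0 : 0 ≤ P := ENNReal.toReal_nonneg
  have haP : a = P ^ p := hval v
  have ha0 : 0 ≤ a := by rw [haP]; positivity
  have ha1 : a ≤ 1 := (integrable_and_integral_le_of_tendsto
    (fun n x => |(u (φ n) : Lp ℝ 2 μ) x| ^ p) _ (fun _ => 1) 1 (fun n => hint _)
    (fun n => Eventually.of_forall fun x => by positivity)
    (by
      filter_upwards [hae] with x hx
      exact hx.abs.rpow_const (Or.inr hp0.le))
    (fun n => (huone _).le) tendsto_const_nhds).2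
  -- In the Sobolev inequality for u n - v the B-term vanishes in the limit, so only the sharp
  -- constant A remains, to be compared with y < 1/A.
  have hsplit : 1 - a ≤ (A * e) ^ (p / 2) := by
    refine one_sub_integral_rpow_le (by linarith) (fun n => (u (φ n) : Lp ℝ 2 μ))
      (fun n => ((u (φ n) - v : E.domain) : Lp ℝ 2 μ)) (v : Lp ℝ 2 μ)
      (fun n => (A * E.form (u (φ n) - v) (u (φ n) - v) + B * ‖u (φ n) - v‖ ^ 2) ^ (p / 2)) _
      (fun n => hint _) (fun n => huone _) (hint v) (fun n => hint _) (fun n => ?_) ?_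
      (fun n => ?_) hae
    · rw [hval]
      set Q := (eLpNorm ((u (φ n) - v : E.domain) : Lp ℝ 2 μ) (ENNReal.ofReal p) μ).toReal
      have hQ0 : 0 ≤ Q := ENNReal.toReal_nonneg
      calc Q ^ p = (Q ^ 2) ^ (p / 2) := by
            rw [← Real.rpow_two, ← Real.rpow_mul hQ0]
            congr 1
            ring
        _ ≤ _ := Real.rpow_le_rpow (by positivity) (hSob _).2 (by positivity)
    · have h1 := (hsub.const_mul A).add ((hnorm.pow 2).const_mul B)
      rw [zero_pow two_ne_zero, mul_zero, add_zero] at h1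
      exact h1.rpow_const (Or.inr (by positivity))
    · filter_upwards [E.coeFn_domain_sub (u (φ n)) v] with x hx
      rw [hx]
      ring
  have hlow := E.mul_rpow_le_schrodingerEnergy hp V y hmin v hvdom (hLp v)
  have haone : a = 1 := by
    refine eq_one_of_split ha0 ha1 hA hY (s := 2 / p) (by positivity)
      ((div_le_one hp0).2 hp.le) (e := e) ?_ ?_
    · have h1 : a ^ (2 / p) = P ^ 2 := by
        rw [haP, ← Real.rpow_mul hP0, mul_div_cancel₀ _ hp0.ne', Real.rpow_two]
      rw [h1]
      linarith
    · calc (1 - a) ^ (2 / p) ≤ ((A * e) ^ (p / 2)) ^ (2 / p) :=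
            Real.rpow_le_rpow (by linarith) hsplit (by positivity)
        _ = A * e := by
          rw [← Real.rpow_mul (by positivity), div_mul_div_cancel₀ two_ne_zero, div_self hp0.ne',
            Real.rpow_one]
  have hPone : P = 1 := by
    rw [haP] at haone
    exact (Real.rpow_left_inj hP0 zero_le_one hp0.ne').1 (haone.trans (Real.one_rpow p).symm)
  have hv1 : eLpNorm (v : Lp ℝ 2 μ) (sobolevExponent ν) μ = 1 :=
    (ENNReal.toReal_eq_one_iff _).1 hPone
  refine ⟨v, hvdom, ?_, hv1⟩
  rw [hy, EReal.coe_eq_coe_iff]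
  exact le_antisymm (by linarith) (hmin v hvdom hv1)
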